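/- Let $\alpha=\frac{1}{96e^{3}}$. For a graph $G$ and $\lambda>0$ let $Z_G(\lambda)=\sum_I\lambda^{|I|}$, the sum over the independent sets $I$ of $G$. A partition $(A,B)$ of $[n]=\{1,\dots,n\}$ is weakly balanced if $\big||A|-|B|\big|\le n/10$. For such a partition and $\lambda>0$, let $\mathcal D_{A,B,\lambda}$ be the set of pairs $(S,T)$ with $S\subseteq\binom A2$, $T\subseteq\binom B2$ such that the graph $S\cup T$ is triangle-free and has maximum degree at most $\alpha/\lambda$, and let $\nu_{A,B,\lambda}$ be the probability distribution on $\mathcal D_{A,B,\lambda}$ given by $$\nu_{A,B,\lambda}(S,T)=\frac{\lambda^{|S|+|T|}Z_{S\square T}(\lambda)}{\sum_{(S',T')\in\mathcal D_{A,B,\lambda}}\lambda^{|S'|+|T'|}Z_{S'\square T'}(\lambda)},$$ where $S\square T$ is the Cartesian product of the graphs $(A,S)$ and $(B,T)$, with vertex set $A\times B$. The edge-update Glauber dynamics for $\nu_{A,B,\lambda}$ is the Markov chain on $\mathcal D_{A,B,\lambda}$ that at each step picks $e\in\binom A2\cup\binom B2$ uniformly at random and resamples whether $e\in S\cup T$ from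 its conditional distribution under $\nu_{A,B,\lambda}$ given the status of all other pairs (if there are no such pairs $e$, the chain stays put). Its mixing time is $$\tau_{\mathrm{mix}}=\max_{X_0\in\mathcal D_{A,B,\lambda}}\min\{t\ge 0:\|\mathcal L(X_t)-\nu_{A,B,\lambda}\|_{TV}<1/4\}.$$ Proposition. There are absolute constants $C,K>0$ such that for every $n\ge2$, every weakly balanced partition $(A,B)$ of $[n]$ and every $\lambda\ge Cn^{-1/2}$, the mixing time of the edge-update Glauber dynamics for $\nu_{A,B,\lambda}$ is at most $K n^{2}\log n$. -/

import Mathlib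

/-! ### Hard-core partition function -/

open Classical in
/-- The hard-core partition function `Z_G(lam)`: the sum of `lam ^ |I|` over the independent
sets `I` of `G`. -/
noncomputable def hardcoreZ {W : Type*} [Fintype W] (G : SimpleGraph W) (lam : ℝ) : ℝ :=
  ∑ I ∈ Finset.univ.filter (fun I : Finset W => G.IsIndepSet (↑I : Set W)), lam ^ I.card

/-! ### Finite Markov chains -/

/-- Total variation distance between two probability mass functions on a finite set. -/
noncomputable def tvDist {Ω : Type*} [Fintype Ω] (μ ν : Ω → ℝ) : ℝ :=
  (1 / 2) * ∑ x, |μ x - ν x|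

/-- Mixing time of a chain with transition matrix `P` and target distribution `π`: the maximum
over starting states `x ∈ S` of the first time `t` at which the law of the chain started
at `x` is at total variation distance less than `1/4` from `π` (`⊤` if there is no such time). -/
noncomputable def mixingTime {Ω : Type*} [Fintype Ω] [DecidableEq Ω]
    (P : Matrix Ω Ω ℝ) (π : Ω → ℝ) (S : Finset Ω) : ℕ∞ :=
  ⨆ x ∈ S, ⨅ t : ℕ, ⨅ _ : tvDist ((P ^ t) x) π < 1 / 4, (t : ℕ∞)

/-! ### Glauber dynamics on subsets of a finite set -/

/-- For a random set with law `μ`, the conditional probability that it contains `e`, given that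
away from `e` it agrees with `X` (and `0` when the conditioning event is null). -/
noncomputable def condMarginal {ι : Type*} [DecidableEq ι] (μ : Finset ι → ℝ)
    (X : Finset ι) (e : ι) : ℝ :=
  μ (insert e X) / (μ (insert e X) + μ (X.erase e))

/-- Transition matrix of the Glauber dynamics for `μ` with coordinate set `E`: pick `e ∈ E`
uniformly at random and resample whether `e` is in the set, conditionally on all other
coordinates. If there are no coordinates the chain does not move. -/
noncomputable def glauberMatrix {ι : Type*} [DecidableEq ι] (E : Finset ι) (μ : Finset ι → ℝ) :
    Matrix (Finset ι) (Finset ι) ℝ :=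
  Matrix.of fun X Y =>
    if E = ∅ then (if Y = X then 1 else 0)
    else (1 / (E.card : ℝ)) * ∑ e ∈ E,
      (condMarginal μ X e * (if Y = insert e X then 1 else 0) +
        (1 - condMarginal μ X e) * (if Y = X.erase e then 1 else 0))

/-! ### The defect distribution -/

/-- `(A, B)` is a weakly balanced partition of the vertex set `Fin n`. -/
structure WeaklyBalanced {n : ℕ} (A B : Finset (Fin n)) : Prop where
  disjoint : Disjoint A B
  union_eq : A ∪ B = Finset.univ
  balance : |(A.card : ℝ) - (B.card : ℝ)| ≤ (n : ℝ) / 10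

/-- The constant `α = 1 / (96 e³)`. -/
noncomputable def defectAlpha : ℝ := 1 / (96 * Real.exp 1 ^ 3)

/-- The unordered pairs of distinct elements of `A`. -/
def pairsIn {n : ℕ} (A : Finset (Fin n)) : Finset (Sym2 (Fin n)) :=
  A.sym2.filter fun e => ¬ e.IsDiag

/-- The possible defect edges: pairs inside `A` together with pairs inside `B`. -/
def defectSlots {n : ℕ} (A B : Finset (Fin n)) : Finset (Sym2 (Fin n)) :=
  pairsIn A ∪ pairsIn B

/-- The graph on `Fin n` with edge set `X`. -/
def graphOf {n : ℕ} (X : Finset (Sym2 (Fin n))) : SimpleGraph (Fin n) :=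
  SimpleGraph.fromEdgeSet (X : Set (Sym2 (Fin n)))

open Classical in
/-- The set of defect configurations. A pair `(S, T)` of graphs on `A` and on `B` is identified
with the edge set `X = S ∪ T`; it is required that `S ∪ T` is triangle-free and has maximum
degree at most `α / lam`. -/
noncomputable def defectSets {n : ℕ} (A B : Finset (Fin n)) (lam : ℝ) :
    Finset (Finset (Sym2 (Fin n))) :=
  (defectSlots A B).powerset.filter fun X =>
    (graphOf X).CliqueFree 3 ∧ ((graphOf X).maxDegree : ℝ) ≤ defectAlpha / lam

/-- The Cartesian product, on vertex set `A × B`, of the graphs that `X` induces on `A`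
and on `B`. -/
def defectBox {n : ℕ} (A B : Finset (Fin n)) (X : Finset (Sym2 (Fin n))) :
    SimpleGraph (A × B) :=
  SimpleGraph.boxProd ((graphOf X).comap (fun a : A => (a : Fin n)))
    ((graphOf X).comap (fun b : B => (b : Fin n)))

/-- The weight `lam ^ (|S| + |T|) * Z_{S □ T}(lam)` of `X = S ∪ T`. -/
noncomputable def defectWeight {n : ℕ} (A B : Finset (Fin n)) (lam : ℝ)
    (X : Finset (Sym2 (Fin n))) : ℝ :=
  lam ^ X.card * hardcoreZ (defectBox A B X) lam

/-- The defect distribution `ν_{A,B,lam}`, as a probability mass function supported on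
`defectSets A B lam`. -/
noncomputable def defectDist {n : ℕ} (A B : Finset (Fin n)) (lam : ℝ)
    (X : Finset (Sym2 (Fin n))) : ℝ :=
  if X ∈ defectSets A B lam then
    defectWeight A B lam X / ∑ Y ∈ defectSets A B lam, defectWeight A B lam Y
  else 0

/-- The mixing time of the edge-update Glauber dynamics for the defect distribution, over all
starting states in its support. -/
noncomputable def defectMixingTime {n : ℕ} (A B : Finset (Fin n)) (lam : ℝ) : ℕ∞ :=
  mixingTime (glauberMatrix (defectSlots A B) (defectDist A B lam)) (defectDist A B lam)
    (defectSets A B lam)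

/-!
The proof is path coupling, run on Lipschitz functions instead of on couplings. Neighbouring states
`X` and `insert f X` are given the distance
`stepWeight D X f = 1 + ∑_{u ∈ f} 2 ^ (deg_X u - D)`, where `D = ⌊α / lam⌋` is the degree bound.
If resampling one uniformly chosen slot contracts the expected distance of all neighbouring states
by the factor `1 - 1 / (2 N)`, `N` being the number of slots, then the transition matrix contracts
Lipschitz constants by the same factor (`EdgeLipschitz.glauberMatrix_mulVec`), and
`tvDist_glauberMatrix_pow_le` yields mixing within `O(N log n)` steps. Choosing the slot `f` itself
removes the disagreement. Against this gain stand three losses.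

* *Soft interaction.* The update probability at `e` is `lam R / (1 + lam R)`, where
  `R = Z(X + e) / Z(X)` is a ratio of hard-core partition functions on the product graphs. Each pair
  `e` adds at least `2 n / 5` edges to the product graph, and each of them costs a factor
  `exp (-lam ^ 2 / 2)`, so `R ≤ exp (-lam ^ 2 n / 5)` (`logRatio_le`). The dependence of `log R`
  on `f` is a second difference of `log Z`. The vertex recursion
  `Z(U) = Z(U - v) + lam Z(U - v - N(v))` bounds the effect of `e` on the occupation ratios by the
  truncated walk-generating function `influence` (`abs_log_erase_sub_le`); inserting the edges of
  `f` one at a time then bounds the second difference (`abs_second_difference_le`). As `lam` times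
  the maximum degree is small, `influence` summed over all `e` stays bounded, and the sum over `e`
  of all second differences is at most `32 lam ^ 3 n ^ 2` (`sum_slotInfluence_le`).
* *Triangles.* At most `2 D` slots are blocked by `f` for closing a triangle.
* *Full vertices.* If an endpoint `u` of `f` has degree `D - 1` in `X`, then `f` may block all the
  slots at `u`. Here the degree penalty in `stepWeight` pays: the edges at `u` disappear at rate
  close to `D`, each halving the penalty, while edges appear at `u` only at rate `n q ≤ D / 100`,
  where `q = lam exp (-lam ^ 2 n / 5)` (`endpoint_drift_le`).

All losses are governed by `y = lam ^ 2 n` through `y ^ 2 exp (-y / 5)`, which is as small as desired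
once `lam ≥ C n ^ (-1 / 2)` with `C` large.
-/

/-! ### Independent-set sums -/

section HardCore

open Classical in
/-- The sum of `lam ^ |I|` over the independent sets `I ⊆ U` of `G`: the hard-core partition
function of the subgraph of `G` induced on `U`. -/
noncomputable def indepSum {V : Type*} (G : SimpleGraph V) (lam : ℝ) (U : Finset V) : ℝ :=
  ∑ I ∈ U.powerset.filter (fun I : Finset V => G.IsIndepSet (↑I : Set V)), lam ^ I.card

open Classical in
/-- The neighbours of `v` in `G`, as a finset. -/
noncomputable def nbrs {V : Type*} [Fintype V] (G : SimpleGraph V) (v : V) : Finset V :=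
  Finset.univ.filter (fun u => G.Adj v u)

variable {V : Type*}

lemma mem_nbrs [Fintype V] {G : SimpleGraph V} {v u : V} : u ∈ nbrs G v ↔ G.Adj v u := by
  simp [nbrs]

lemma indepSum_univ [Fintype V] (G : SimpleGraph V) (lam : ℝ) :
    indepSum G lam Finset.univ = hardcoreZ G lam := by
  classical
  unfold indepSum hardcoreZ
  rw [Finset.powerset_univ]

lemma indepSum_pos (G : SimpleGraph V) {lam : ℝ} (hl : 0 < lam) (U : Finset V) :
    0 < indepSum G lam U := by
  classical
  unfold indepSum
  apply Finset.sum_pos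
  · intro I _; positivity
  · exact ⟨∅, by simp⟩

lemma indepSum_congr {G H : SimpleGraph V} (lam : ℝ) {U : Finset V}
    (h : ∀ x ∈ U, ∀ y ∈ U, (G.Adj x y ↔ H.Adj x y)) : indepSum G lam U = indepSum H lam U := by
  classical
  unfold indepSum
  congr 1
  apply Finset.filter_congr
  intro I hI
  rw [Finset.mem_powerset] at hI
  simp only [SimpleGraph.IsIndepSet, Set.Pairwise]
  constructor
  · intro hh x hx y hy hxy
    rw [← h x (hI hx) y (hI hy)]
    exact hh hx hy hxy
  · intro hh x hx y hy hxy
    rw [h x (hI hx) y (hI hy)]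
    exact hh hx hy hxy

lemma log_indepSum_mono (G : SimpleGraph V) {lam : ℝ} (hl : 0 < lam) {W U : Finset V}
    (h : W ⊆ U) : Real.log (indepSum G lam W) ≤ Real.log (indepSum G lam U) := by
  apply Real.log_le_log (indepSum_pos G hl _)
  unfold indepSum
  refine Finset.sum_le_sum_of_subset_of_nonneg (fun I hI => ?_) ?_
  · simp only [Finset.mem_filter, Finset.mem_powerset] at hI ⊢
    exact ⟨hI.1.trans h, hI.2⟩
  intros; positivity

lemma log_indepSum_sdiff_le [DecidableEq V] (G : SimpleGraph V) {lam : ℝ} (hl : 0 < lam)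
    (U T : Finset V) :
    Real.log (indepSum G lam (U \ T)) ≤ Real.log (indepSum G lam U) :=
  log_indepSum_mono G hl Finset.sdiff_subset

/-- Passing from a bound on single vertices to a bound on sets of vertices: the vertices of `T`
are removed one at a time. -/
lemma abs_log_sdiff_sub_le_of_erase [DecidableEq V] {G H : SimpleGraph V} {lam : ℝ}
    {F : V → ℝ} {U : Finset V}
    (hF : ∀ v, 0 ≤ F v)
    (h : ∀ W ⊆ U, ∀ v ∈ W,
      |(Real.log (indepSum G lam W) - Real.log (indepSum G lam (W.erase v)))
        - (Real.log (indepSum H lam W) - Real.log (indepSum H lam (W.erase v)))| ≤ F v)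
    (T : Finset V) :
    |(Real.log (indepSum G lam U) - Real.log (indepSum G lam (U \ T)))
      - (Real.log (indepSum H lam U) - Real.log (indepSum H lam (U \ T)))| ≤ ∑ u ∈ T, F u := by
  induction T using Finset.induction_on with
  | empty => simp
  | insert v T hv ih =>
    rw [Finset.sum_insert hv]
    have hset : U \ insert v T = (U \ T).erase v := by
      ext z; simp only [Finset.mem_sdiff, Finset.mem_insert, Finset.mem_erase]; tauto
    rw [hset]
    by_cases hvU : v ∈ U \ T
    · have := h (U \ T) Finset.sdiff_subset v hvU
      rw [abs_le] at *
      constructor <;> linarith [ih.1, ih.2, this.1, this.2]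
    · rw [Finset.erase_eq_of_notMem hvU]
      linarith [hF v]

variable [Fintype V]

/-- The partial Neumann sum `∑_{j < k} (lam A)^j s`, where `A` is the adjacency matrix of `K`:
the number of walks in `K` of length less than `k`, with a factor `lam` for each step, counted
from `v` and weighted by `s` at their end. -/
noncomputable def influence (K : SimpleGraph V) (lam : ℝ) (s : V → ℝ) : ℕ → V → ℝ
  | 0, _ => 0
  | k + 1, v => s v + lam * ∑ u ∈ nbrs K v, influence K lam s k u

lemma influence_nonneg (K : SimpleGraph V) {lam : ℝ} (hl : 0 < lam) {s : V → ℝ}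
    (hs : ∀ v, 0 ≤ s v) : ∀ k v, 0 ≤ influence K lam s k v
  | 0, _ => le_rfl
  | k + 1, v => add_nonneg (hs v) (mul_nonneg hl.le
      (Finset.sum_nonneg fun u _ => influence_nonneg K hl hs k u))

variable [DecidableEq V]

/-- The recursion of the independent-set sum on whether a vertex is occupied. -/
lemma indepSum_vertex (G : SimpleGraph V) (lam : ℝ) {U : Finset V} {v : V} (hv : v ∈ U) :
    indepSum G lam U
      = indepSum G lam (U.erase v) + lam * indepSum G lam (U.erase v \ nbrs G v) := by
  classical
  unfold indepSum
  conv_lhs => rw [← Finset.sum_filter_add_sum_filter_not _ (fun I => v ∉ I)]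
  congr 1
  · apply Finset.sum_congr _ (fun _ _ => rfl)
    ext I
    simp only [Finset.mem_filter, Finset.mem_powerset, Finset.subset_erase]
    tauto
  · rw [Finset.mul_sum]
    symm
    apply Finset.sum_bij (fun I _ => insert v I)
    · intro I hI
      simp only [Finset.mem_filter, Finset.mem_powerset] at hI ⊢
      obtain ⟨hI1, hI2⟩ := hI
      refine ⟨⟨?_, ?_⟩, by simp⟩
      · apply Finset.insert_subset hv
        exact hI1.trans (Finset.sdiff_subset.trans (Finset.erase_subset _ _))
      · have : ∀ x ∈ I, ¬ G.Adj v x := by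
          intro x hx hadj
          have := hI1 hx
          rw [Finset.mem_sdiff, mem_nbrs] at this
          exact this.2 hadj
        rw [Finset.coe_insert]
        simp only [SimpleGraph.IsIndepSet] at hI2 ⊢
        apply hI2.insert
        intro b hb _
        exact ⟨this b hb, fun h => this b hb h.symm⟩
    · intro I hI J hJ hIJ
      simp only [Finset.mem_filter, Finset.mem_powerset] at hI hJ
      have hvI : v ∉ I := fun h => by simpa using hI.1 h
      have hvJ : v ∉ J := fun h => by simpa using hJ.1 h
      rw [← Finset.erase_insert hvI, ← Finset.erase_insert hvJ]
      exact congrArg (fun s => Finset.erase s v) hIJ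
    · intro J hJ
      simp only [Finset.mem_filter, Finset.mem_powerset, not_not] at hJ
      obtain ⟨⟨hJ1, hJ2⟩, hvJ⟩ := hJ
      refine ⟨J.erase v, ?_, Finset.insert_erase hvJ⟩
      simp only [Finset.mem_filter, Finset.mem_powerset]
      refine ⟨?_, ?_⟩
      · intro x hx
        rw [Finset.mem_erase] at hx
        rw [Finset.mem_sdiff, Finset.mem_erase, mem_nbrs]
        exact ⟨⟨hx.1, hJ1 hx.2⟩, hJ2 hvJ hx.2 (Ne.symm hx.1)⟩
      · exact Set.Pairwise.mono (by simp) hJ2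
    · intro I hI
      simp only [Finset.mem_filter, Finset.mem_powerset] at hI
      have hvI : v ∉ I := fun h => by simpa using hI.1 h
      rw [Finset.card_insert_of_notMem hvI]
      ring

/-- Adding an edge kills exactly the independent sets that contain both of its endpoints. -/
lemma indepSum_edge (G : SimpleGraph V) (lam : ℝ) {U : Finset V} {x y : V} (hx : x ∈ U)
    (hy : y ∈ U) (hne : x ≠ y) (hadj : ¬ G.Adj x y) :
    indepSum (G ⊔ SimpleGraph.edge x y) lam U = indepSum G lam U
      - lam ^ 2 * indepSum G lam (U \ (insert x (insert y (nbrs G x ∪ nbrs G y)))) := by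
  have h1 := indepSum_vertex (G ⊔ SimpleGraph.edge x y) lam hx
  have h2 := indepSum_vertex G lam hx
  have hy' : y ∈ U.erase x \ nbrs G x := by
    rw [Finset.mem_sdiff, Finset.mem_erase, mem_nbrs]; exact ⟨⟨hne.symm, hy⟩, hadj⟩
  have h3 := indepSum_vertex G lam hy'
  have e1 : indepSum (G ⊔ SimpleGraph.edge x y) lam (U.erase x)
      = indepSum G lam (U.erase x) := by
    apply indepSum_congr
    intro a ha b hb
    rw [Finset.mem_erase] at ha hb
    simp only [SimpleGraph.sup_adj, SimpleGraph.edge_adj]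
    grind
  have e2 : indepSum (G ⊔ SimpleGraph.edge x y) lam
      (U.erase x \ nbrs (G ⊔ SimpleGraph.edge x y) x)
      = indepSum G lam ((U.erase x \ nbrs G x).erase y) := by
    have : U.erase x \ nbrs (G ⊔ SimpleGraph.edge x y) x = (U.erase x \ nbrs G x).erase y := by
      ext z
      simp only [Finset.mem_sdiff, Finset.mem_erase, mem_nbrs, SimpleGraph.sup_adj,
        SimpleGraph.edge_adj]
      grind
    rw [this]
    apply indepSum_congr
    intro a ha b hb
    simp only [Finset.mem_erase, Finset.mem_sdiff] at ha hb
    simp only [SimpleGraph.sup_adj, SimpleGraph.edge_adj]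
    grind
  have e3 : (U.erase x \ nbrs G x).erase y \ nbrs G y
      = U \ (insert x (insert y (nbrs G x ∪ nbrs G y))) := by
    ext z
    simp only [Finset.mem_sdiff, Finset.mem_erase, Finset.mem_insert, Finset.mem_union]
    tauto
  rw [e1, e2] at h1
  rw [e3] at h3
  rw [h1, h2, h3]
  ring

/-! ### Logarithms of independent-set sums -/

lemma log_indepSum_erase (G : SimpleGraph V) {lam : ℝ} (hl : 0 < lam) {U : Finset V} {v : V}
    (hv : v ∈ U) :
    Real.log (indepSum G lam U) - Real.log (indepSum G lam (U.erase v))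
      = Real.log (1 + lam * Real.exp (-(Real.log (indepSum G lam (U.erase v))
          - Real.log (indepSum G lam (U.erase v \ nbrs G v))))) := by
  have h1 := indepSum_pos G hl (U.erase v)
  have h2 := indepSum_pos G hl (U.erase v \ nbrs G v)
  rw [neg_sub, Real.exp_sub, Real.exp_log h1, Real.exp_log h2,
    ← Real.log_div (indepSum_pos G hl U).ne' h1.ne', indepSum_vertex G lam hv]
  congr 1
  field_simp

lemma log_indepSum_le_sdiff (G : SimpleGraph V) {lam : ℝ} (hl : 0 < lam) (U T : Finset V) :
    Real.log (indepSum G lam U) ≤ Real.log (indepSum G lam (U \ T)) + lam * T.card := by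
  induction T using Finset.induction_on with
  | empty => simp
  | insert v T hv ih =>
    rw [Finset.card_insert_of_notMem hv]
    have hset : U \ insert v T = (U \ T).erase v := by
      ext z; simp only [Finset.mem_sdiff, Finset.mem_insert, Finset.mem_erase]; tauto
    rw [hset]
    by_cases hvU : v ∈ U \ T
    · have h := log_indepSum_erase G hl hvU
      have h3 := log_indepSum_sdiff_le G hl ((U \ T).erase v) (nbrs G v)
      have h4 : Real.exp (-(Real.log (indepSum G lam ((U \ T).erase v))
          - Real.log (indepSum G lam ((U \ T).erase v \ nbrs G v)))) ≤ 1 :=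
        Real.exp_le_one_iff.2 (by linarith)
      have h5 := Real.log_le_sub_one_of_pos (show 0 < 1 + lam *
        Real.exp (-(Real.log (indepSum G lam ((U \ T).erase v))
          - Real.log (indepSum G lam ((U \ T).erase v \ nbrs G v)))) by positivity)
      have h6 := mul_le_mul_of_nonneg_left h4 hl.le
      push_cast
      linarith
    · rw [Finset.erase_eq_of_notMem hvU]
      push_cast
      linarith

lemma exp_neg_sub_exp_neg_le {s t : ℝ} (hs : 0 ≤ s) :
    Real.exp (-s) - Real.exp (-t) ≤ |s - t| := by
  rcases le_total s t with h | h
  · have h1 : Real.exp (-t) = Real.exp (-s) * Real.exp (-(t - s)) := by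
      rw [← Real.exp_add]; congr 1; ring
    have h2 := Real.add_one_le_exp (-(t - s))
    have h3 : Real.exp (-s) ≤ 1 := Real.exp_le_one_iff.2 (by linarith)
    have h4 := Real.exp_pos (-s)
    rw [h1, abs_sub_comm, abs_of_nonneg (by linarith : 0 ≤ t - s)]
    nlinarith
  · have : Real.exp (-s) ≤ Real.exp (-t) := Real.exp_le_exp.2 (by linarith)
    linarith [abs_nonneg (s - t)]

lemma abs_exp_neg_sub_exp_neg_le {s t : ℝ} (hs : 0 ≤ s) (ht : 0 ≤ t) :
    |Real.exp (-s) - Real.exp (-t)| ≤ |s - t| := by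
  rw [abs_le]
  have h1 := exp_neg_sub_exp_neg_le hs (t := t)
  have h2 := exp_neg_sub_exp_neg_le ht (t := s)
  rw [abs_sub_comm] at h2
  constructor <;> linarith

lemma log_sub_log_le_div {a b c : ℝ} (hc : 0 < c) (ha : c ≤ a) (hb : c ≤ b) :
    |Real.log a - Real.log b| ≤ |a - b| / c := by
  have key : ∀ a b : ℝ, c ≤ a → c ≤ b → Real.log a - Real.log b ≤ |a - b| / c := by
    intro a b ha hb
    have ha0 := hc.trans_le ha
    have hb0 := hc.trans_le hb
    rw [← Real.log_div ha0.ne' hb0.ne']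
    have h := Real.log_le_sub_one_of_pos (div_pos ha0 hb0)
    have h2 : a / b - 1 = (a - b) / b := by field_simp
    rw [h2] at h
    calc _ ≤ (a - b) / b := h
      _ ≤ |a - b| / b := by gcongr; exact le_abs_self _
      _ ≤ |a - b| / c := by gcongr
  rw [abs_le]
  have h1 := key a b ha hb
  have h2 := key b a hb ha
  rw [abs_sub_comm] at h2
  constructor <;> linarith

lemma abs_log_one_add_mul_exp_sub_le {lam s t : ℝ} (hl : 0 < lam) (hs : 0 ≤ s) (ht : 0 ≤ t) :
    |Real.log (1 + lam * Real.exp (-s)) - Real.log (1 + lam * Real.exp (-t))|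
      ≤ lam * |s - t| := by
  have h := log_sub_log_le_div (c := 1) one_pos
    (show 1 ≤ 1 + lam * Real.exp (-s) by have := Real.exp_pos (-s); nlinarith)
    (show 1 ≤ 1 + lam * Real.exp (-t) by have := Real.exp_pos (-t); nlinarith)
  refine h.trans ?_
  rw [div_one, show 1 + lam * Real.exp (-s) - (1 + lam * Real.exp (-t))
    = lam * (Real.exp (-s) - Real.exp (-t)) by ring, abs_mul, abs_of_pos hl]
  exact mul_le_mul_of_nonneg_left (abs_exp_neg_sub_exp_neg_le hs ht) hl.le

lemma abs_log_one_sub_mul_exp_sub_le {c s t : ℝ} (hc : 0 < c) (hc2 : c ≤ 1 / 2) (hs : 0 ≤ s)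
    (ht : 0 ≤ t) :
    |Real.log (1 - c * Real.exp (-s)) - Real.log (1 - c * Real.exp (-t))|
      ≤ 2 * c * |s - t| := by
  have hs1 : Real.exp (-s) ≤ 1 := Real.exp_le_one_iff.2 (by linarith)
  have ht1 : Real.exp (-t) ≤ 1 := Real.exp_le_one_iff.2 (by linarith)
  have h := log_sub_log_le_div (c := 1 / 2) (by norm_num)
    (show 1 / 2 ≤ 1 - c * Real.exp (-s) by nlinarith)
    (show 1 / 2 ≤ 1 - c * Real.exp (-t) by nlinarith)
  refine h.trans ?_
  rw [show 1 - c * Real.exp (-s) - (1 - c * Real.exp (-t))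
    = c * (Real.exp (-t) - Real.exp (-s)) by ring, abs_mul, abs_of_pos hc]
  have := mul_le_mul_of_nonneg_left (abs_exp_neg_sub_exp_neg_le ht hs) hc.le
  rw [abs_sub_comm t s] at this
  linarith

end HardCore

/-! ### Influence bounds for the hard-core model -/

section Influence

variable {V : Type*} [Fintype V]

lemma influence_le_succ (K : SimpleGraph V) {lam : ℝ} (hl : 0 < lam) {s : V → ℝ}
    (hs : ∀ v, 0 ≤ s v) : ∀ k v, influence K lam s k v ≤ influence K lam s (k + 1) v
  | 0, v => influence_nonneg K hl hs 1 v
  | k + 1, v => by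
    have h := Finset.sum_le_sum fun u (_ : u ∈ nbrs K v) => influence_le_succ K hl hs k u
    have := mul_le_mul_of_nonneg_left h hl.le
    rw [influence, influence]
    linarith

/-- If `lam` times the maximum degree is at most `1 / 2`, then the influences of sources whose
total at each vertex is at most `c` have total at most `2 c` at each vertex. -/
lemma sum_influence_le {ι : Type*} (E : Finset ι) (K : SimpleGraph V) {lam : ℝ} (hl : 0 < lam)
    (s : ι → V → ℝ) {c : ℝ} (hc : ∀ v, ∑ e ∈ E, s e v ≤ c) (hc0 : 0 ≤ c)
    (hdeg : ∀ v, lam * (nbrs K v).card ≤ 1 / 2) (k : ℕ) (v : V) :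
    ∑ e ∈ E, influence K lam (s e) k v ≤ 2 * c := by
  induction k generalizing v with
  | zero => simp [influence]; exact hc0
  | succ k ih =>
    simp only [influence]
    rw [Finset.sum_add_distrib, ← Finset.mul_sum, Finset.sum_comm]
    have h1 : ∑ u ∈ nbrs K v, ∑ e ∈ E, influence K lam (s e) k u
        ≤ (nbrs K v).card * (2 * c) := by
      rw [← nsmul_eq_mul]
      exact Finset.sum_le_card_nsmul _ _ _ fun u _ => ih u
    have h2 := mul_le_mul_of_nonneg_left h1 hl.le
    have h3 := mul_le_mul_of_nonneg_right (hdeg v) (show 0 ≤ 2 * c by linarith)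
    have := hc v
    nlinarith

variable [DecidableEq V]

/-- The occupation ratio of a vertex changes by at most `lam ^ 2` times the influence when edges
are added to the graph: `s v` bounds the number of edges that `v` gains. -/
lemma abs_log_erase_sub_le {H H' K : SimpleGraph V} {lam : ℝ} (hl : 0 < lam) {s : V → ℝ}
    (hHK : H ≤ K) (hHH' : H ≤ H') (hs : ∀ v, ((nbrs H' v \ nbrs H v).card : ℝ) ≤ s v) (k : ℕ) :
    ∀ U : Finset V, U.card ≤ k → ∀ v ∈ U,
      |(Real.log (indepSum H lam U) - Real.log (indepSum H lam (U.erase v)))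
        - (Real.log (indepSum H' lam U) - Real.log (indepSum H' lam (U.erase v)))|
        ≤ lam ^ 2 * influence K lam s k v := by
  have hs0 : ∀ v, 0 ≤ s v := fun v => (Nat.cast_nonneg _).trans (hs v)
  induction k with
  | zero =>
    intro U hU v hv
    rw [Nat.le_zero, Finset.card_eq_zero] at hU
    simp [hU] at hv
  | succ k ih =>
    intro U hU v hv
    rw [log_indepSum_erase H hl hv, log_indepSum_erase H' hl hv]
    have hU' : (U.erase v).card ≤ k := by rw [Finset.card_erase_of_mem hv]; omega
    set U' := U.erase v with hU'def
    have hN : nbrs H v ⊆ nbrs H' v := fun u hu => mem_nbrs.2 (hHH' (mem_nbrs.1 hu))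
    have hset : U' \ nbrs H' v = (U' \ nbrs H v) \ (nbrs H' v \ nbrs H v) := by
      ext z; simp only [Finset.mem_sdiff]
      have := @hN z
      tauto
    have h1 := abs_log_sdiff_sub_le_of_erase (G := H) (H := H') (lam := lam) (U := U')
      (F := fun u => lam ^ 2 * influence K lam s k u)
      (fun u => mul_nonneg (sq_nonneg _) (influence_nonneg K hl hs0 k u))
      (fun W hW w hw => ih W ((Finset.card_le_card hW).trans hU') w hw) (nbrs H v)
    have h2 := log_indepSum_sdiff_le H' hl (U' \ nbrs H v) (nbrs H' v \ nbrs H v)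
    have h3 := log_indepSum_le_sdiff H' hl (U' \ nbrs H v) (nbrs H' v \ nbrs H v)
    rw [← hset] at h2 h3
    have h4 := log_indepSum_sdiff_le H hl U' (nbrs H v)
    have h5 := log_indepSum_sdiff_le H' hl U' (nbrs H' v)
    -- Both ratios are `1 + lam * exp (-s)`. The exponents differ by the influence on the common
    -- neighbours of `v`, which are covered by induction, and by at most `lam` for each new one.
    refine (abs_log_one_add_mul_exp_sub_le hl (by linarith) (by linarith)).trans ?_
    rw [← Finset.mul_sum] at h1
    have h6 : ∑ u ∈ nbrs H v, influence K lam s k u ≤ ∑ u ∈ nbrs K v, influence K lam s k u :=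
      Finset.sum_le_sum_of_subset_of_nonneg
        (fun u hu => mem_nbrs.2 (hHK (mem_nbrs.1 hu)))
        (fun u _ _ => influence_nonneg K hl hs0 k u)
    have h7 := mul_le_mul_of_nonneg_left (hs v) hl.le
    have h8 := mul_le_mul_of_nonneg_left h6 (sq_nonneg lam)
    have h9 : |Real.log (indepSum H lam U') - Real.log (indepSum H lam (U' \ nbrs H v))
        - (Real.log (indepSum H' lam U') - Real.log (indepSum H' lam (U' \ nbrs H' v)))|
        ≤ lam * s v + lam ^ 2 * ∑ u ∈ nbrs K v, influence K lam s k u := by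
      rw [abs_le] at *
      constructor <;> linarith [h1.1, h1.2]
    refine (mul_le_mul_of_nonneg_left h9 hl.le).trans (le_of_eq ?_)
    rw [influence]
    ring

/-- The closed neighbourhood of the pair `x`, `y`. The independent sets that contain both `x` and
`y`, for `x` and `y` not adjacent, correspond to those of the graph without these vertices. -/
noncomputable def pairNbrs (G : SimpleGraph V) (x y : V) : Finset V :=
  insert x (insert y (nbrs G x ∪ nbrs G y))

/-- The change in log partition function caused by adding an edge; `lam ^ 2 * exp (-s)` is the
probability that both endpoints are occupied. -/
lemma log_indepSum_edge {G : SimpleGraph V} {lam : ℝ} (hl : 0 < lam) {x y : V} (hne : x ≠ y)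
    (hadj : ¬ G.Adj x y) :
    Real.log (indepSum (G ⊔ SimpleGraph.edge x y) lam Finset.univ)
        - Real.log (indepSum G lam Finset.univ)
      = Real.log (1 - lam ^ 2 * Real.exp (-(Real.log (indepSum G lam Finset.univ)
        - Real.log (indepSum G lam (Finset.univ \ pairNbrs G x y))))) := by
  have h1 := indepSum_pos G hl Finset.univ
  have h2 := indepSum_pos G hl (Finset.univ \ pairNbrs G x y)
  rw [neg_sub, Real.exp_sub, Real.exp_log h1, Real.exp_log h2,
    ← Real.log_div (indepSum_pos _ hl _).ne' h1.ne',
    indepSum_edge G lam (Finset.mem_univ x) (Finset.mem_univ y) hne hadj]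
  congr 1
  rw [pairNbrs]
  field_simp

lemma sum_pairNbrs_le (G : SimpleGraph V) (x y : V) {F : V → ℝ} (hF : ∀ v, 0 ≤ F v) :
    ∑ u ∈ pairNbrs G x y, F u
      ≤ F x + F y + (∑ u ∈ nbrs G x, F u) + ∑ u ∈ nbrs G y, F u := by
  have h1 : ∀ (a : V) (S : Finset V), ∑ u ∈ insert a S, F u ≤ F a + ∑ u ∈ S, F u := by
    intro a S
    by_cases h : a ∈ S
    · rw [Finset.insert_eq_of_mem h]; linarith [hF a]
    · rw [Finset.sum_insert h]
  have h2 := Finset.sum_union_inter (s₁ := nbrs G x) (s₂ := nbrs G y) (f := F)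
  have h3 : 0 ≤ ∑ u ∈ nbrs G x ∩ nbrs G y, F u := Finset.sum_nonneg fun u _ => hF u
  rw [pairNbrs]
  linarith [h1 x (insert y (nbrs G x ∪ nbrs G y)), h1 y (nbrs G x ∪ nbrs G y)]

/-- The second difference of the log partition function, for the addition of one edge on the one
side and the passage from `H` to `H'` on the other. -/
lemma abs_second_difference_edge_le {H H' K : SimpleGraph V} {lam : ℝ} (hl : 0 < lam)
    (hl2 : lam ≤ 1 / 2) {s : V → ℝ} (hHK : H ≤ K) (hHH' : H ≤ H')
    (hs : ∀ v, ((nbrs H' v \ nbrs H v).card : ℝ) ≤ s v) {x y : V} (hne : x ≠ y)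
    (hadj : ¬ H'.Adj x y) :
    |(Real.log (indepSum (H ⊔ SimpleGraph.edge x y) lam Finset.univ)
        - Real.log (indepSum H lam Finset.univ))
      - (Real.log (indepSum (H' ⊔ SimpleGraph.edge x y) lam Finset.univ)
        - Real.log (indepSum H' lam Finset.univ))|
      ≤ 4 * lam ^ 3 * (influence K lam s (Fintype.card V + 1) x
          + influence K lam s (Fintype.card V + 1) y) := by
  have hs0 : ∀ v, 0 ≤ s v := fun v => (Nat.cast_nonneg _).trans (hs v)
  rw [log_indepSum_edge hl hne (fun h => hadj (hHH' h)), log_indepSum_edge hl hne hadj]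
  set k := Fintype.card V with hk
  have hN : pairNbrs H x y ⊆ pairNbrs H' x y := by
    intro u
    simp only [pairNbrs, Finset.mem_insert, Finset.mem_union, mem_nbrs]
    have h1 := @hHH' x u
    have h2 := @hHH' y u
    tauto
  have hset : Finset.univ \ pairNbrs H' x y
      = (Finset.univ \ pairNbrs H x y) \ (pairNbrs H' x y \ pairNbrs H x y) := by
    ext z; simp only [Finset.mem_sdiff]
    have := @hN z
    tauto
  have hcard : ((pairNbrs H' x y \ pairNbrs H x y).card : ℝ) ≤ s x + s y := by
    have : pairNbrs H' x y \ pairNbrs H x y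
        ⊆ (nbrs H' x \ nbrs H x) ∪ (nbrs H' y \ nbrs H y) := by
      intro u
      simp only [pairNbrs, Finset.mem_insert, Finset.mem_union, Finset.mem_sdiff]
      tauto
    have h := (Finset.card_le_card this).trans (Finset.card_union_le _ _)
    have h' : ((pairNbrs H' x y \ pairNbrs H x y).card : ℝ)
      ≤ (nbrs H' x \ nbrs H x).card + (nbrs H' y \ nbrs H y).card := by exact_mod_cast h
    linarith [hs x, hs y]
  have h1 := abs_log_sdiff_sub_le_of_erase (G := H) (H := H') (lam := lam) (U := Finset.univ)
    (F := fun u => lam ^ 2 * influence K lam s k u)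
    (fun u => mul_nonneg (sq_nonneg _) (influence_nonneg K hl hs0 k u))
    (fun W hW w hw => abs_log_erase_sub_le hl hHK hHH' hs k W (Finset.card_le_univ W) w hw)
    (pairNbrs H x y)
  have h2 := log_indepSum_sdiff_le H' hl (Finset.univ \ pairNbrs H x y)
    (pairNbrs H' x y \ pairNbrs H x y)
  have h3 := log_indepSum_le_sdiff H' hl (Finset.univ \ pairNbrs H x y)
    (pairNbrs H' x y \ pairNbrs H x y)
  rw [← hset] at h2 h3
  have h4 := log_indepSum_sdiff_le H hl Finset.univ (pairNbrs H x y)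
  have h5 := log_indepSum_sdiff_le H' hl Finset.univ (pairNbrs H' x y)
  have hlsq : lam ^ 2 ≤ 1 / 2 := by nlinarith
  refine (abs_log_one_sub_mul_exp_sub_le (by positivity) hlsq (by linarith)
    (by linarith)).trans ?_
  rw [← Finset.mul_sum] at h1
  have h6 : ∀ v, ∑ u ∈ nbrs H v, influence K lam s k u ≤ ∑ u ∈ nbrs K v, influence K lam s k u :=
    fun v => Finset.sum_le_sum_of_subset_of_nonneg
      (fun u hu => mem_nbrs.2 (hHK (mem_nbrs.1 hu)))
      (fun u _ _ => influence_nonneg K hl hs0 k u)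
  have h7 := mul_le_mul_of_nonneg_left hcard hl.le
  have h8 := mul_le_mul_of_nonneg_left (sum_pairNbrs_le H x y (influence_nonneg K hl hs0 k))
    (sq_nonneg lam)
  have h9 := mul_le_mul_of_nonneg_left (add_le_add (h6 x) (h6 y)) (sq_nonneg lam)
  have hF : ∀ v, lam ^ 2 * influence K lam s k v + lam * s v
      + lam ^ 2 * ∑ u ∈ nbrs K v, influence K lam s k u
      ≤ 2 * lam * influence K lam s (k + 1) v := by
    intro v
    have a1 := influence_le_succ K hl hs0 k v
    have a2 := influence_nonneg K hl hs0 k v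
    have a3 : lam ^ 2 * influence K lam s k v ≤ lam * influence K lam s (k + 1) v := by
      rw [pow_two, mul_assoc]
      apply mul_le_mul_of_nonneg_left _ hl.le
      nlinarith
    have a4 : lam * influence K lam s (k + 1) v
      = lam * s v + lam ^ 2 * ∑ u ∈ nbrs K v, influence K lam s k u := by
      rw [influence]; ring
    linarith
  have h10 : |Real.log (indepSum H lam Finset.univ)
        - Real.log (indepSum H lam (Finset.univ \ pairNbrs H x y))
      - (Real.log (indepSum H' lam Finset.univ)
        - Real.log (indepSum H' lam (Finset.univ \ pairNbrs H' x y)))|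
      ≤ 2 * lam * (influence K lam s (k + 1) x + influence K lam s (k + 1) y) := by
    have := hF x
    have := hF y
    rw [abs_le] at *
    constructor <;> linarith [h1.1, h1.2]
  refine (mul_le_mul_of_nonneg_left h10 (by positivity)).trans (le_of_eq ?_)
  ring

/-- The second difference of the log partition function, for the addition of the edge set `M` on
the one side and the passage from `H` to `H'` on the other. -/
lemma abs_second_difference_le {H H' K : SimpleGraph V} {lam : ℝ} (hl : 0 < lam)
    (hl2 : lam ≤ 1 / 2) {s : V → ℝ} (hHH' : H ≤ H')
    (hs : ∀ v, ((nbrs H' v \ nbrs H v).card : ℝ) ≤ s v) (M : Finset (Sym2 V))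
    (hHK : H ⊔ SimpleGraph.fromEdgeSet (M : Set (Sym2 V)) ≤ K)
    (hM : ∀ m ∈ M, ¬ m.IsDiag ∧ m ∉ H'.edgeSet) :
    |(Real.log (indepSum (H ⊔ SimpleGraph.fromEdgeSet (M : Set (Sym2 V))) lam Finset.univ)
        - Real.log (indepSum H lam Finset.univ))
      - (Real.log (indepSum (H' ⊔ SimpleGraph.fromEdgeSet (M : Set (Sym2 V))) lam Finset.univ)
        - Real.log (indepSum H' lam Finset.univ))|
      ≤ 4 * lam ^ 3 * ∑ m ∈ M, ∑ v ∈ Finset.univ.filter (· ∈ m),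
          influence K lam s (Fintype.card V + 1) v := by
  induction M using Finset.induction_on with
  | empty => simp
  | insert m M hm ih =>
    have hins : ∀ G : SimpleGraph V,
        G ⊔ SimpleGraph.fromEdgeSet ((insert m M : Finset (Sym2 V)) : Set (Sym2 V))
        = (G ⊔ SimpleGraph.fromEdgeSet (M : Set (Sym2 V)))
          ⊔ SimpleGraph.fromEdgeSet {m} := by
      intro G
      rw [sup_assoc, ← SimpleGraph.fromEdgeSet_union, Finset.coe_insert, Set.insert_eq,
        Set.union_comm]
    rw [hins] at hHK
    have ih' := ih (le_sup_left.trans hHK) (fun e he => hM e (Finset.mem_insert_of_mem he))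
    obtain ⟨hd, hmem⟩ := hM m (Finset.mem_insert_self _ _)
    rw [Finset.sum_insert hm, hins H, hins H']
    induction m with
    | _ x y =>
    have hne : x ≠ y := by simpa using hd
    have hadj : ¬ (H' ⊔ SimpleGraph.fromEdgeSet (M : Set (Sym2 V))).Adj x y := by
      rw [SimpleGraph.sup_adj, SimpleGraph.fromEdgeSet_adj]
      rintro (h | h)
      · exact hmem h
      · exact hm (by simpa using h.1)
    have hone := abs_second_difference_edge_le (H := H ⊔ SimpleGraph.fromEdgeSet (M : Set (Sym2 V)))
      (H' := H' ⊔ SimpleGraph.fromEdgeSet (M : Set (Sym2 V))) (K := K) hl hl2 (s := s)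
      (le_sup_left.trans hHK) (sup_le_sup_right hHH' _) (fun v => by
        refine le_trans ?_ (hs v)
        have : nbrs (H' ⊔ SimpleGraph.fromEdgeSet (M : Set (Sym2 V))) v
            \ nbrs (H ⊔ SimpleGraph.fromEdgeSet (M : Set (Sym2 V))) v
            ⊆ nbrs H' v \ nbrs H v := by
          intro u
          simp only [Finset.mem_sdiff, mem_nbrs, SimpleGraph.sup_adj]
          tauto
        exact_mod_cast Finset.card_le_card this) hne hadj
    rw [SimpleGraph.edge] at hone
    have hfil : Finset.univ.filter (· ∈ s(x, y)) = {x, y} := by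
      ext z; simp
    rw [hfil, Finset.sum_pair hne, mul_add]
    rw [abs_le] at *
    constructor <;> linarith [ih'.1, ih'.2, hone.1, hone.2]

/-- Each added edge multiplies the partition function by at most `exp (-lam ^ 2 / 2)`, as long as
the degrees are small compared with `1 / lam`. -/
lemma log_indepSum_sup_fromEdgeSet_le {H : SimpleGraph V} {lam d : ℝ} (hl : 0 < lam)
    (M : Finset (Sym2 V)) (hM : ∀ m ∈ M, ¬ m.IsDiag ∧ m ∉ H.edgeSet)
    (hdeg : ∀ v, ((nbrs (H ⊔ SimpleGraph.fromEdgeSet (M : Set (Sym2 V))) v).card : ℝ) ≤ d)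
    (hd : lam * (2 * d + 2) ≤ 1 / 2) :
    Real.log (indepSum (H ⊔ SimpleGraph.fromEdgeSet (M : Set (Sym2 V))) lam Finset.univ)
      ≤ Real.log (indepSum H lam Finset.univ) - M.card * (lam ^ 2 / 2) := by
  induction M using Finset.induction_on with
  | empty => simp
  | insert m M hm ih =>
    have hins : H ⊔ SimpleGraph.fromEdgeSet ((insert m M : Finset (Sym2 V)) : Set (Sym2 V))
        = (H ⊔ SimpleGraph.fromEdgeSet (M : Set (Sym2 V)))
          ⊔ SimpleGraph.fromEdgeSet {m} := by
      rw [sup_assoc, ← SimpleGraph.fromEdgeSet_union, Finset.coe_insert, Set.insert_eq,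
        Set.union_comm]
    rw [hins] at hdeg ⊢
    set H1 := H ⊔ SimpleGraph.fromEdgeSet (M : Set (Sym2 V)) with hH1
    have hdeg1 : ∀ v, ((nbrs H1 v).card : ℝ) ≤ d := fun v => by
      refine le_trans ?_ (hdeg v)
      have : nbrs H1 v ⊆ nbrs (H1 ⊔ SimpleGraph.fromEdgeSet {m}) v := fun u hu =>
        mem_nbrs.2 (Or.inl (mem_nbrs.1 hu))
      exact_mod_cast Finset.card_le_card this
    have ih' := ih (fun e he => hM e (Finset.mem_insert_of_mem he)) hdeg1
    obtain ⟨hdg, hmem⟩ := hM m (Finset.mem_insert_self _ _)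
    rw [Finset.card_insert_of_notMem hm]
    induction m with
    | _ x y =>
    have hne : x ≠ y := by simpa using hdg
    have hadj : ¬ H1.Adj x y := by
      rw [hH1, SimpleGraph.sup_adj, SimpleGraph.fromEdgeSet_adj]
      rintro (h | h)
      · exact hmem h
      · exact hm (by simpa using h.1)
    have he := log_indepSum_edge hl hne hadj
    rw [SimpleGraph.edge] at he
    have hcard : ((pairNbrs H1 x y).card : ℝ) ≤ 2 * d + 2 := by
      have := sum_pairNbrs_le H1 x y (F := fun _ => 1) (fun _ => zero_le_one)
      simp only [Finset.sum_const, nsmul_eq_mul, mul_one] at this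
      linarith [hdeg1 x, hdeg1 y]
    have h1 := log_indepSum_le_sdiff H1 hl Finset.univ (pairNbrs H1 x y)
    have h2 := mul_le_mul_of_nonneg_left hcard hl.le
    have h3 := Real.add_one_le_exp (-(Real.log (indepSum H1 lam Finset.univ)
      - Real.log (indepSum H1 lam (Finset.univ \ pairNbrs H1 x y))))
    have h4 := Real.log_le_sub_one_of_pos (x := 1 - lam ^ 2 * Real.exp
      (-(Real.log (indepSum H1 lam Finset.univ)
      - Real.log (indepSum H1 lam (Finset.univ \ pairNbrs H1 x y))))) (by
        have h5 := log_indepSum_sdiff_le H1 hl Finset.univ (pairNbrs H1 x y)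
        have h6 : Real.exp (-(Real.log (indepSum H1 lam Finset.univ)
          - Real.log (indepSum H1 lam (Finset.univ \ pairNbrs H1 x y)))) ≤ 1 :=
          Real.exp_le_one_iff.2 (by linarith)
        have hd0 : 0 ≤ d := (Nat.cast_nonneg _).trans (hdeg1 x)
        have : lam ≤ 1 / 4 := by nlinarith
        nlinarith)
    have h7 : lam ^ 2 * (1 / 2) ≤ lam ^ 2 * Real.exp (-(Real.log (indepSum H1 lam Finset.univ)
      - Real.log (indepSum H1 lam (Finset.univ \ pairNbrs H1 x y)))) := by
      apply mul_le_mul_of_nonneg_left _ (sq_nonneg _)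
      linarith
    push_cast
    linarith

end Influence

/-! ### Path coupling for Glauber dynamics, in dual form -/

section Glauber

variable {ι : Type*} [DecidableEq ι]

lemma insert_erase_self_eq (X : Finset ι) (e : ι) : insert e (X.erase e) = insert e X := by
  ext z
  simp only [Finset.mem_insert, Finset.mem_erase]
  tauto

lemma condMarginal_insert_self (μ : Finset ι → ℝ) (X : Finset ι) (e : ι) :
    condMarginal μ (insert e X) e = condMarginal μ X e := by
  unfold condMarginal
  rw [Finset.insert_idem, Finset.erase_insert_eq_erase]

lemma condMarginal_erase_self (μ : Finset ι → ℝ) (X : Finset ι) (e : ι) :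
    condMarginal μ (X.erase e) e = condMarginal μ X e := by
  unfold condMarginal
  rw [insert_erase_self_eq, Finset.erase_idem]

lemma condMarginal_nonneg {μ : Finset ι → ℝ} (hμ : ∀ X, 0 ≤ μ X) (X : Finset ι) (e : ι) :
    0 ≤ condMarginal μ X e :=
  div_nonneg (hμ _) (add_nonneg (hμ _) (hμ _))

lemma condMarginal_le_one {μ : Finset ι → ℝ} (hμ : ∀ X, 0 ≤ μ X) (X : Finset ι) (e : ι) :
    condMarginal μ X e ≤ 1 :=
  div_le_one_of_le₀ (by linarith [hμ (X.erase e)]) (add_nonneg (hμ _) (hμ _))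

/-- `g` changes by at most `L * w X f` when `f` is added to `X` inside the support `S`. -/
def EdgeLipschitz (S : Finset (Finset ι)) (w : Finset ι → ι → ℝ) (L : ℝ)
    (g : Finset ι → ℝ) : Prop :=
  ∀ X f, f ∉ X → insert f X ∈ S → |g (insert f X) - g X| ≤ L * w X f

/-- The expected weighted distance after resampling `e` in both of the neighbouring states `X`
and `insert f X`, coupled optimally. -/
noncomputable def coupledWeight (μ : Finset ι → ℝ) (w : Finset ι → ι → ℝ) (X : Finset ι)
    (f e : ι) : ℝ :=
  condMarginal μ (insert f X) e * w (insert e X) f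
    + (1 - condMarginal μ (insert f X) e) * w (X.erase e) f
    + |condMarginal μ X e - condMarginal μ (insert f X) e| * w (X.erase e) e

lemma condMarginal_eq_zero {S : Finset (Finset ι)} {μ : Finset ι → ℝ}
    (hμS : ∀ X, X ∉ S → μ X = 0) {X : Finset ι} {e : ι} (h : insert e X ∉ S) :
    condMarginal μ X e = 0 := by
  simp [condMarginal, hμS _ h]

/-- A state is joined to the empty state by a path of as many steps as it has elements. -/
lemma EdgeLipschitz.abs_sub_empty_le {S : Finset (Finset ι)} (hS : ∀ X ∈ S, ∀ Y ⊆ X, Y ∈ S)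
    {w : Finset ι → ι → ℝ} {L W : ℝ} (hL : 0 ≤ L)
    (hw : ∀ X f, f ∉ X → insert f X ∈ S → w X f ≤ W)
    {g : Finset ι → ℝ} (hg : EdgeLipschitz S w L g) {X : Finset ι} (hX : X ∈ S) :
    |g X - g ∅| ≤ X.card * (L * W) := by
  induction X using Finset.induction_on with
  | empty => simp
  | insert f X hf ih =>
    have h1 := ih (hS _ hX _ (Finset.subset_insert _ _))
    have h2 := hg X f hf hX
    have h3 := mul_le_mul_of_nonneg_left (hw X f hf hX) hL
    rw [Finset.card_insert_of_notMem hf]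
    push_cast
    rw [abs_le] at *
    constructor <;> linarith [h1.1, h1.2, h2.1, h2.2]

variable [Fintype ι]

/-- The action of the Glauber transition matrix on functions. -/
lemma glauberMatrix_mulVec {E : Finset ι} (hE : E.Nonempty) (μ g : Finset ι → ℝ)
    (X : Finset ι) :
    ((glauberMatrix E μ).mulVec g) X = (1 / (E.card : ℝ)) * ∑ e ∈ E,
      (condMarginal μ X e * g (insert e X) + (1 - condMarginal μ X e) * g (X.erase e)) := by
  simp only [Matrix.mulVec, dotProduct, glauberMatrix, Matrix.of_apply, if_neg hE.ne_empty]
  simp only [mul_assoc, ← Finset.mul_sum]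
  congr 1
  simp only [Finset.sum_mul]
  rw [Finset.sum_comm]
  apply Finset.sum_congr rfl
  intro e _
  simp only [add_mul, Finset.sum_add_distrib, mul_assoc, ite_mul, one_mul, zero_mul,
    ← Finset.mul_sum, Finset.sum_ite_eq', Finset.mem_univ, if_true]

/-- Resampling one coordinate preserves `μ`. -/
lemma sum_mul_resample {μ : Finset ι → ℝ} (hμ : ∀ X, 0 ≤ μ X) (g : Finset ι → ℝ) (e : ι) :
    ∑ X, μ X * (condMarginal μ X e * g (insert e X) + (1 - condMarginal μ X e) * g (X.erase e))
      = ∑ X, μ X * g X := by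
  have hsplit : ∀ f : Finset ι → ℝ, ∑ X, f X
      = ∑ X ∈ Finset.univ.filter (fun X : Finset ι => e ∉ X), (f X + f (insert e X)) := by
    intro f
    rw [Finset.sum_add_distrib, ← Finset.sum_filter_add_sum_filter_not Finset.univ
      (fun X : Finset ι => e ∉ X)]
    congr 1
    symm
    apply Finset.sum_bij (fun X _ => insert e X)
    · intro X _; simp
    · intro X hX Y hY h
      simp only [Finset.mem_filter, Finset.mem_univ, true_and] at hX hY
      rw [← Finset.erase_insert hX, ← Finset.erase_insert hY]
      exact congrArg (fun s => Finset.erase s e) h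
    · intro Y hY
      simp only [Finset.mem_filter, Finset.mem_univ, true_and, not_not] at hY
      exact ⟨Y.erase e, by simp, Finset.insert_erase hY⟩
    · intro X _; rfl
  rw [hsplit, hsplit]
  apply Finset.sum_congr rfl
  intro X hX
  simp only [Finset.mem_filter, Finset.mem_univ, true_and] at hX
  rw [condMarginal_insert_self, Finset.insert_idem, Finset.erase_insert hX,
    Finset.erase_eq_of_notMem hX]
  have key : (μ X + μ (insert e X)) * condMarginal μ X e = μ (insert e X) := by
    unfold condMarginal
    rw [Finset.erase_eq_of_notMem hX]
    have h1 := hμ X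
    have h2 := hμ (insert e X)
    by_cases h : μ (insert e X) + μ X = 0
    · have : μ (insert e X) = 0 := by linarith
      simp [this]
    · rw [add_comm (μ X)]
      field_simp
  linear_combination (g (insert e X) - g X) * key

lemma sum_mul_glauberMatrix_mulVec {E : Finset ι} (hE : E.Nonempty) {μ : Finset ι → ℝ}
    (hμ : ∀ X, 0 ≤ μ X) (g : Finset ι → ℝ) :
    ∑ X, μ X * ((glauberMatrix E μ).mulVec g) X = ∑ X, μ X * g X := by
  simp only [glauberMatrix_mulVec hE]
  have hcard : (E.card : ℝ) ≠ 0 := by exact_mod_cast hE.card_pos.ne'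
  calc _ = (1 / (E.card : ℝ)) * ∑ e ∈ E, ∑ X, μ X * (condMarginal μ X e * g (insert e X)
        + (1 - condMarginal μ X e) * g (X.erase e)) := by
        rw [Finset.sum_comm, Finset.mul_sum]
        apply Finset.sum_congr rfl
        intro X _
        rw [← Finset.mul_sum]
        ring
    _ = _ := by
        simp only [sum_mul_resample hμ, Finset.sum_const, nsmul_eq_mul]
        field_simp

lemma sum_mul_glauberMatrix_pow_mulVec {E : Finset ι} (hE : E.Nonempty) {μ : Finset ι → ℝ}
    (hμ : ∀ X, 0 ≤ μ X) (g : Finset ι → ℝ) (t : ℕ) :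
    ∑ X, μ X * ((glauberMatrix E μ ^ t).mulVec g) X = ∑ X, μ X * g X := by
  induction t with
  | zero => simp
  | succ t ih =>
    rw [pow_succ', ← Matrix.mulVec_mulVec, sum_mul_glauberMatrix_mulVec hE hμ, ih]

/-- Contraction of the coupled weights makes the Glauber dynamics contract Lipschitz constants. -/
lemma EdgeLipschitz.glauberMatrix_mulVec {E : Finset ι} (hE : E.Nonempty)
    {S : Finset (Finset ι)} (hSE : ∀ X ∈ S, X ⊆ E) (hS : ∀ X ∈ S, ∀ Y ⊆ X, Y ∈ S)
    {μ : Finset ι → ℝ} (hμ : ∀ X, 0 ≤ μ X) (hμS : ∀ X, X ∉ S → μ X = 0)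
    {w : Finset ι → ι → ℝ} {r : ℝ}
    (hcon : ∀ X f, f ∉ X → insert f X ∈ S →
      ∑ e ∈ E.erase f, coupledWeight μ w X f e ≤ (E.card : ℝ) * (r * w X f))
    {L : ℝ} (hL : 0 ≤ L) {g : Finset ι → ℝ} (hg : EdgeLipschitz S w L g) :
    EdgeLipschitz S w (L * r) ((glauberMatrix E μ).mulVec g) := by
  intro X f hf hfS
  have hcard : (0 : ℝ) < E.card := by exact_mod_cast hE.card_pos
  rw [_root_.glauberMatrix_mulVec hE, _root_.glauberMatrix_mulVec hE, ← mul_sub,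
    ← Finset.sum_sub_distrib, abs_mul, abs_of_pos (by positivity)]
  have hfE : f ∈ E := hSE _ hfS (Finset.mem_insert_self _ _)
  rw [← Finset.add_sum_erase _ _ hfE]
  have h0 : condMarginal μ (insert f X) f * g (insert f (insert f X)) +
        (1 - condMarginal μ (insert f X) f) * g ((insert f X).erase f) -
      (condMarginal μ X f * g (insert f X) + (1 - condMarginal μ X f) * g (X.erase f)) = 0 := by
    rw [condMarginal_insert_self, Finset.insert_idem, Finset.erase_insert_eq_erase]
    ring
  rw [h0, zero_add]
  have hterm : ∀ e ∈ E.erase f,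
      |condMarginal μ (insert f X) e * g (insert e (insert f X)) +
        (1 - condMarginal μ (insert f X) e) * g ((insert f X).erase e) -
      (condMarginal μ X e * g (insert e X) + (1 - condMarginal μ X e) * g (X.erase e))|
      ≤ L * coupledWeight μ w X f e := by
    intro e he
    have hef : e ≠ f := (Finset.mem_erase.1 he).1
    have hY1 : insert e (insert f X) = insert f (insert e X) := Finset.insert_comm _ _ _
    have hY2 : (insert f X).erase e = insert f (X.erase e) :=
      Finset.erase_insert_of_ne (Ne.symm hef)
    have p0 := condMarginal_nonneg hμ (insert f X) e
    have p1 := condMarginal_le_one hμ (insert f X) e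
    have t1 : |condMarginal μ (insert f X) e * (g (insert f (insert e X)) - g (insert e X))|
        ≤ condMarginal μ (insert f X) e * (L * w (insert e X) f) := by
      rw [abs_mul, abs_of_nonneg p0]
      by_cases h : insert f (insert e X) ∈ S
      · apply mul_le_mul_of_nonneg_left _ p0
        apply hg _ _ _ h
        simp [hf, Ne.symm hef]
      · rw [← hY1] at h
        rw [condMarginal_eq_zero hμS h]
        simp
    have t2 : |(1 - condMarginal μ (insert f X) e) * (g (insert f (X.erase e)) - g (X.erase e))|
        ≤ (1 - condMarginal μ (insert f X) e) * (L * w (X.erase e) f) := by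
      rw [abs_mul, abs_of_nonneg (by linarith)]
      apply mul_le_mul_of_nonneg_left _ (by linarith)
      apply hg _ _ (fun h => hf (Finset.mem_of_mem_erase h))
      exact hS _ hfS _ (Finset.insert_subset_insert _ (Finset.erase_subset _ _))
    have t3 : |(condMarginal μ X e - condMarginal μ (insert f X) e)
          * (g (insert e X) - g (X.erase e))|
        ≤ |condMarginal μ X e - condMarginal μ (insert f X) e| * (L * w (X.erase e) e) := by
      rw [abs_mul]
      by_cases h : insert e X ∈ S
      · apply mul_le_mul_of_nonneg_left _ (abs_nonneg _)
        have := hg (X.erase e) e (by simp) (by rwa [insert_erase_self_eq])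
        rwa [insert_erase_self_eq] at this
      · have h' : insert e (insert f X) ∉ S := fun h' => h (hS _ h' _
          (Finset.insert_subset_insert _ (Finset.subset_insert _ _)))
        rw [condMarginal_eq_zero hμS h, condMarginal_eq_zero hμS h']
        simp
    rw [hY1, hY2, coupledWeight]
    rw [abs_le] at *
    constructor <;> linarith [t1.1, t1.2, t2.1, t2.2, t3.1, t3.2]
  have hsum := (Finset.abs_sum_le_sum_abs _ _).trans (Finset.sum_le_sum hterm)
  rw [← Finset.mul_sum] at hsum
  have h1 := mul_le_mul_of_nonneg_left (hcon X f hf hfS) hL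
  have h2 := hsum.trans h1
  calc _ ≤ 1 / (E.card : ℝ) * (L * ((E.card : ℝ) * (r * w X f))) :=
        mul_le_mul_of_nonneg_left h2 (by positivity)
    _ = _ := by field_simp

lemma EdgeLipschitz.glauberMatrix_pow_mulVec {E : Finset ι} (hE : E.Nonempty)
    {S : Finset (Finset ι)} (hSE : ∀ X ∈ S, X ⊆ E) (hS : ∀ X ∈ S, ∀ Y ⊆ X, Y ∈ S)
    {μ : Finset ι → ℝ} (hμ : ∀ X, 0 ≤ μ X) (hμS : ∀ X, X ∉ S → μ X = 0)
    {w : Finset ι → ι → ℝ} {r : ℝ} (hr : 0 ≤ r)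
    (hcon : ∀ X f, f ∉ X → insert f X ∈ S →
      ∑ e ∈ E.erase f, coupledWeight μ w X f e ≤ (E.card : ℝ) * (r * w X f))
    {L : ℝ} (hL : 0 ≤ L) {g : Finset ι → ℝ} (hg : EdgeLipschitz S w L g) (t : ℕ) :
    EdgeLipschitz S w (L * r ^ t) ((glauberMatrix E μ ^ t).mulVec g) := by
  induction t with
  | zero => simpa using hg
  | succ t ih =>
    rw [pow_succ' (glauberMatrix E μ), ← Matrix.mulVec_mulVec, pow_succ, ← mul_assoc]
    exact ih.glauberMatrix_mulVec hE hSE hS hμ hμS hcon (by positivity)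

/-- Total variation bound for Glauber dynamics whose coupled weights contract by the factor `r`. -/
lemma tvDist_glauberMatrix_pow_le {E : Finset ι} (hE : E.Nonempty)
    {S : Finset (Finset ι)} (hSE : ∀ X ∈ S, X ⊆ E) (hS : ∀ X ∈ S, ∀ Y ⊆ X, Y ∈ S)
    {μ : Finset ι → ℝ} (hμ : ∀ X, 0 ≤ μ X) (hμS : ∀ X, X ∉ S → μ X = 0) (hμ1 : ∑ X, μ X = 1)
    {w : Finset ι → ι → ℝ} {r W : ℝ} (hr : 0 ≤ r)
    (hw1 : ∀ X f, f ∉ X → insert f X ∈ S → 1 ≤ w X f)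
    (hw : ∀ X f, f ∉ X → insert f X ∈ S → w X f ≤ W) (hW : 0 ≤ W)
    (hcon : ∀ X f, f ∉ X → insert f X ∈ S →
      ∑ e ∈ E.erase f, coupledWeight μ w X f e ≤ (E.card : ℝ) * (r * w X f))
    {X : Finset ι} (hX : X ∈ S) (t : ℕ) :
    tvDist ((glauberMatrix E μ ^ t) X) μ ≤ 2 * E.card * W * r ^ t := by
  set P := glauberMatrix E μ with hP
  -- The test function that attains the total variation distance.
  set g : Finset ι → ℝ := fun Y => SignType.sign ((P ^ t) X Y - μ Y) with hg
  have hgabs : ∀ Y, |g Y| ≤ 1 := by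
    intro Y
    rw [hg]
    rcases lt_trichotomy ((P ^ t) X Y - μ Y) 0 with h | h | h
    · simp [sign_neg h]
    · simp [h]
    · simp [sign_pos h]
  have hgL : EdgeLipschitz S w 2 g := by
    intro Y f hf hfS
    have h1 := hgabs (insert f Y)
    have h2 := hgabs Y
    have h3 := hw1 Y f hf hfS
    rw [abs_le] at *
    constructor <;> linarith [h1.1, h1.2, h2.1, h2.2]
  have hPL := hgL.glauberMatrix_pow_mulVec hE hSE hS hμ hμS hr hcon (by norm_num) t
  rw [← hP] at hPL
  set G := (P ^ t).mulVec g with hG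
  have hb : ∀ Y ∈ S, |G Y - G ∅| ≤ E.card * (2 * r ^ t * W) := by
    intro Y hY
    refine (hPL.abs_sub_empty_le hS (by positivity) hw hY).trans ?_
    apply mul_le_mul_of_nonneg_right _ (by positivity)
    exact_mod_cast Finset.card_le_card (hSE Y hY)
  have htv : tvDist ((P ^ t) X) μ = 1 / 2 * ∑ Y, μ Y * (G X - G Y) := by
    unfold tvDist
    congr 1
    have e1 : ∑ Y, |(P ^ t) X Y - μ Y| = ∑ Y, ((P ^ t) X Y - μ Y) * g Y := by
      apply Finset.sum_congr rfl
      intro Y _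
      rw [hg, self_mul_sign]
    have e2 : ∑ Y, ((P ^ t) X Y - μ Y) * g Y = G X - ∑ Y, μ Y * g Y := by
      simp only [sub_mul, Finset.sum_sub_distrib]
      rfl
    have e3 := sum_mul_glauberMatrix_pow_mulVec hE hμ g t
    rw [e1, e2, ← e3]
    simp only [mul_sub, Finset.sum_sub_distrib, ← Finset.sum_mul, hμ1, one_mul]
    rfl
  rw [htv]
  have hle : ∑ Y, μ Y * (G X - G Y) ≤ ∑ Y, μ Y * (2 * (E.card * (2 * r ^ t * W))) := by
    apply Finset.sum_le_sum
    intro Y _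
    by_cases hY : Y ∈ S
    · apply mul_le_mul_of_nonneg_left _ (hμ Y)
      have h1 := hb X hX
      have h2 := hb Y hY
      rw [abs_le] at h1 h2
      linarith [h1.2, h2.1]
    · rw [hμS Y hY]; simp
  rw [← Finset.sum_mul, hμ1, one_mul] at hle
  linarith

end Glauber

/-! ### The product graph of a defect configuration -/

section DefectBox

variable {n : ℕ}

/-- The number of pairs in `X` that contain `u`. -/
def edgeDeg (X : Finset (Sym2 (Fin n))) (u : Fin n) : ℕ := (X.filter (u ∈ ·)).card

lemma edgeDeg_mono {X Y : Finset (Sym2 (Fin n))} (h : X ⊆ Y) (u : Fin n) :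
    edgeDeg X u ≤ edgeDeg Y u :=
  Finset.card_le_card (Finset.filter_subset_filter _ h)

lemma edgeDeg_insert {X : Finset (Sym2 (Fin n))} {e : Sym2 (Fin n)} (he : e ∉ X) (u : Fin n) :
    edgeDeg (insert e X) u = edgeDeg X u + if u ∈ e then 1 else 0 := by
  unfold edgeDeg
  rw [Finset.filter_insert]
  split_ifs with h
  · rw [Finset.card_insert_of_notMem (by simp [he])]
  · simp

lemma edgeDeg_singleton (e : Sym2 (Fin n)) (u : Fin n) :
    edgeDeg {e} u = if u ∈ e then 1 else 0 := by
  unfold edgeDeg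
  rw [Finset.filter_singleton]
  split_ifs <;> simp

lemma edgeDeg_le (X : Finset (Sym2 (Fin n))) (u : Fin n) : edgeDeg X u ≤ n := by
  have : X.filter (u ∈ ·) ⊆ Finset.univ.image (fun w => s(u, w)) := by
    intro e he
    rw [Finset.mem_filter] at he
    obtain ⟨w, rfl⟩ := Sym2.mem_iff_exists.1 he.2
    simp
  calc _ ≤ _ := Finset.card_le_card this
    _ ≤ _ := Finset.card_image_le
    _ = n := by simp

lemma graphOf_adj {X : Finset (Sym2 (Fin n))} {u v : Fin n} :
    (graphOf X).Adj u v ↔ s(u, v) ∈ X ∧ u ≠ v := by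
  simp [graphOf]

lemma graphOf_mono {X Y : Finset (Sym2 (Fin n))} (h : X ⊆ Y) : graphOf X ≤ graphOf Y :=
  SimpleGraph.fromEdgeSet_mono (by exact_mod_cast h)

lemma card_nbrs_graphOf {X : Finset (Sym2 (Fin n))} (hX : ∀ e ∈ X, ¬ e.IsDiag) (u : Fin n) :
    (nbrs (graphOf X) u).card = edgeDeg X u := by
  unfold edgeDeg
  apply Finset.card_bij (fun w _ => s(u, w))
  · intro w hw
    rw [mem_nbrs, graphOf_adj] at hw
    simp [hw.1]
  · intro w _ w' _ h
    exact Sym2.congr_right.1 h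
  · intro e he
    rw [Finset.mem_filter] at he
    obtain ⟨w, rfl⟩ := Sym2.mem_iff_exists.1 he.2
    exact ⟨w, mem_nbrs.2 (graphOf_adj.2 ⟨he.1, by simpa using hX _ he.1⟩), rfl⟩

lemma degree_eq_card_nbrs {V : Type*} [Fintype V] (G : SimpleGraph V) (v : V)
    [Fintype (G.neighborSet v)] : G.degree v = (nbrs G v).card := by
  rw [← SimpleGraph.card_neighborFinset_eq_degree]
  congr 1
  ext u
  simp [mem_nbrs]

lemma maxDegree_le_iff_card_nbrs_le {V : Type*} [Fintype V] (G : SimpleGraph V)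
    [DecidableRel G.Adj] (k : ℕ) : G.maxDegree ≤ k ↔ ∀ u, (nbrs G u).card ≤ k := by
  constructor
  · intro h u
    rw [← degree_eq_card_nbrs]
    exact (SimpleGraph.degree_le_maxDegree _ u).trans h
  · intro h
    apply SimpleGraph.maxDegree_le_of_forall_degree_le
    intro u
    rw [degree_eq_card_nbrs]
    exact h u

lemma not_isDiag_of_mem_defectSlots {A B : Finset (Fin n)} {e : Sym2 (Fin n)}
    (he : e ∈ defectSlots A B) : ¬ e.IsDiag := by
  simp only [defectSlots, pairsIn, Finset.mem_union, Finset.mem_filter] at he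
  tauto

lemma mem_defectSets {A B : Finset (Fin n)} {lam : ℝ} (hl : 0 < lam)
    {X : Finset (Sym2 (Fin n))} :
    X ∈ defectSets A B lam ↔ X ⊆ defectSlots A B ∧ (graphOf X).CliqueFree 3 ∧
      ∀ u, edgeDeg X u ≤ ⌊defectAlpha / lam⌋₊ := by
  have hα : 0 ≤ defectAlpha / lam := by unfold defectAlpha; positivity
  unfold defectSets
  simp only [Finset.mem_filter, Finset.mem_powerset]
  refine and_congr_right fun hX => and_congr_right fun _ => ?_
  rw [← Nat.le_floor_iff hα, maxDegree_le_iff_card_nbrs_le]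
  simp only [card_nbrs_graphOf (fun e he => not_isDiag_of_mem_defectSlots (hX he))]

lemma subset_mem_defectSets {A B : Finset (Fin n)} {lam : ℝ} (hl : 0 < lam)
    {X Y : Finset (Sym2 (Fin n))} (hX : X ∈ defectSets A B lam) (hYX : Y ⊆ X) :
    Y ∈ defectSets A B lam := by
  rw [mem_defectSets hl] at *
  exact ⟨hYX.trans hX.1, hX.2.1.anti (graphOf_mono hYX),
    fun u => (edgeDeg_mono hYX u).trans (hX.2.2 u)⟩

variable (A B : Finset (Fin n))

lemma defectBox_adj {X : Finset (Sym2 (Fin n))} {p q : A × B} :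
    (defectBox A B X).Adj p q ↔
      (s((p.1 : Fin n), (q.1 : Fin n)) ∈ X ∧ (p.1 : Fin n) ≠ q.1 ∧ p.2 = q.2) ∨
      (s((p.2 : Fin n), (q.2 : Fin n)) ∈ X ∧ (p.2 : Fin n) ≠ q.2 ∧ p.1 = q.1) := by
  unfold defectBox
  rw [SimpleGraph.boxProd_adj, SimpleGraph.comap_adj, SimpleGraph.comap_adj, graphOf_adj,
    graphOf_adj]
  tauto

lemma defectBox_mono {X Y : Finset (Sym2 (Fin n))} (h : X ⊆ Y) :
    defectBox A B X ≤ defectBox A B Y := by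
  intro p q
  rw [defectBox_adj, defectBox_adj]
  have := @h s((p.1 : Fin n), (q.1 : Fin n))
  have := @h s((p.2 : Fin n), (q.2 : Fin n))
  tauto

open Classical in
/-- The edges that a defect edge `f` contributes to the product graph. -/
noncomputable def boxEdges (f : Sym2 (Fin n)) : Finset (Sym2 (A × B)) :=
  Finset.univ.filter (· ∈ (defectBox A B {f}).edgeSet)

lemma mem_boxEdges {f : Sym2 (Fin n)} {m : Sym2 (A × B)} :
    m ∈ boxEdges A B f ↔ m ∈ (defectBox A B {f}).edgeSet := by
  simp [boxEdges]

lemma defectBox_insert (X : Finset (Sym2 (Fin n))) (f : Sym2 (Fin n)) :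
    defectBox A B (insert f X)
      = defectBox A B X ⊔ SimpleGraph.fromEdgeSet (boxEdges A B f : Set (Sym2 (A × B))) := by
  have : (boxEdges A B f : Set (Sym2 (A × B))) = (defectBox A B {f}).edgeSet := by
    ext m; simp [mem_boxEdges]
  rw [this, SimpleGraph.fromEdgeSet_edgeSet]
  ext p q
  simp only [SimpleGraph.sup_adj, defectBox_adj, Finset.mem_insert, Finset.mem_singleton]
  tauto

lemma boxEdges_disjoint {X : Finset (Sym2 (Fin n))} {f : Sym2 (Fin n)} (hf : f ∉ X) :
    ∀ m ∈ boxEdges A B f, ¬ m.IsDiag ∧ m ∉ (defectBox A B X).edgeSet := by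
  intro m hm
  rw [mem_boxEdges] at hm
  refine ⟨SimpleGraph.not_isDiag_of_mem_edgeSet _ hm, ?_⟩
  induction m with
  | _ p q =>
  rw [SimpleGraph.mem_edgeSet, defectBox_adj] at hm ⊢
  simp only [Finset.mem_singleton] at hm
  rintro (h | h) <;> rcases hm with hm | hm
  · exact hf (hm.1 ▸ h.1)
  · exact hm.2.1 (congrArg Subtype.val h.2.2)
  · exact hm.2.1 (congrArg Subtype.val h.2.2)
  · exact hf (hm.1 ▸ h.1)

lemma card_nbrs_defectBox_le (X : Finset (Sym2 (Fin n))) (v : A × B) :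
    (nbrs (defectBox A B X) v).card ≤ edgeDeg X v.1 + edgeDeg X v.2 := by
  classical
  have hsub : nbrs (defectBox A B X) v
      ⊆ (Finset.univ.filter (fun q : A × B =>
          s((v.1 : Fin n), (q.1 : Fin n)) ∈ X ∧ v.2 = q.2))
        ∪ (Finset.univ.filter (fun q : A × B =>
          s((v.2 : Fin n), (q.2 : Fin n)) ∈ X ∧ v.1 = q.1)) := by
    intro q hq
    rw [mem_nbrs, defectBox_adj] at hq
    simp only [Finset.mem_union, Finset.mem_filter, Finset.mem_univ, true_and]
    tauto
  refine (Finset.card_le_card hsub).trans ((Finset.card_union_le _ _).trans (add_le_add ?_ ?_))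
  · apply Finset.card_le_card_of_injOn (fun q => s((v.1 : Fin n), (q.1 : Fin n)))
    · intro q hq
      simp only [Finset.coe_filter, Finset.mem_univ, true_and, Set.mem_ofPred_eq] at hq ⊢
      exact ⟨hq.1, by simp⟩
    · intro q hq q' hq' h
      simp only [Finset.coe_filter, Finset.mem_univ, true_and, Set.mem_ofPred_eq] at hq hq'
      have h1 : (q.1 : Fin n) = q'.1 := Sym2.congr_right.1 h
      exact Prod.ext (Subtype.ext h1) (hq.2.symm.trans hq'.2)
  · apply Finset.card_le_card_of_injOn (fun q => s((v.2 : Fin n), (q.2 : Fin n)))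
    · intro q hq
      simp only [Finset.coe_filter, Finset.mem_univ, true_and, Set.mem_ofPred_eq] at hq ⊢
      exact ⟨hq.1, by simp⟩
    · intro q hq q' hq' h
      simp only [Finset.coe_filter, Finset.mem_univ, true_and, Set.mem_ofPred_eq] at hq hq'
      have h1 : (q.2 : Fin n) = q'.2 := Sym2.congr_right.1 h
      exact Prod.ext (hq.2.symm.trans hq'.2) (Subtype.ext h1)

/-- The number of coordinates of the vertex `v` of the product graph that lie in the pair `e`;
a bound for the number of edges at `v` that `e` contributes. -/
noncomputable def slotCount (e : Sym2 (Fin n)) (v : A × B) : ℝ :=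
  (if (v.1 : Fin n) ∈ e then 1 else 0) + (if (v.2 : Fin n) ∈ e then 1 else 0)

lemma slotCount_nonneg (e : Sym2 (Fin n)) (v : A × B) : 0 ≤ slotCount A B e v := by
  unfold slotCount
  positivity

lemma card_nbrs_defectBox_singleton_le (e : Sym2 (Fin n)) (v : A × B) :
    ((nbrs (defectBox A B {e}) v).card : ℝ) ≤ slotCount A B e v := by
  have h : ((nbrs (defectBox A B {e}) v).card : ℝ) ≤ (edgeDeg {e} v.1 + edgeDeg {e} v.2 : ℕ) := by
    exact_mod_cast card_nbrs_defectBox_le A B {e} v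
  rw [edgeDeg_singleton, edgeDeg_singleton] at h
  push_cast at h
  exact h

lemma card_nbrs_insert_sdiff_le (X : Finset (Sym2 (Fin n))) (e : Sym2 (Fin n)) (v : A × B) :
    ((nbrs (defectBox A B (insert e X)) v \ nbrs (defectBox A B X) v).card : ℝ)
      ≤ slotCount A B e v := by
  refine le_trans ?_ (card_nbrs_defectBox_singleton_le A B e v)
  have : nbrs (defectBox A B (insert e X)) v \ nbrs (defectBox A B X) v
      ⊆ nbrs (defectBox A B {e}) v := by
    intro q
    simp only [Finset.mem_sdiff, mem_nbrs, defectBox_adj, Finset.mem_insert,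
      Finset.mem_singleton]
    tauto
  exact_mod_cast Finset.card_le_card this

lemma sum_slotCount_slots_le (E : Finset (Sym2 (Fin n))) (v : A × B) :
    ∑ e ∈ E, slotCount A B e v ≤ 2 * n := by
  simp only [slotCount, Finset.sum_add_distrib, Finset.sum_boole]
  have h1 : ((E.filter ((v.1 : Fin n) ∈ ·)).card : ℝ) ≤ n := by
    exact_mod_cast edgeDeg_le E v.1
  have h2 : ((E.filter ((v.2 : Fin n) ∈ ·)).card : ℝ) ≤ n := by
    exact_mod_cast edgeDeg_le E v.2
  linarith

lemma card_filter_mem_sym2_le (f : Sym2 (Fin n)) :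
    (Finset.univ.filter (fun u : Fin n => u ∈ f)).card ≤ 2 := by
  induction f with
  | _ x y =>
  have : Finset.univ.filter (fun u : Fin n => u ∈ s(x, y)) = {x, y} := by ext; simp
  rw [this]
  exact Finset.card_le_two

lemma card_filter_coe_mem_sym2_le (A : Finset (Fin n)) (f : Sym2 (Fin n)) :
    (Finset.univ.filter (fun a : A => (a : Fin n) ∈ f)).card ≤ 2 := by
  refine le_trans ?_ (card_filter_mem_sym2_le f)
  apply Finset.card_le_card_of_injOn (fun a : A => (a : Fin n))
  · intro a ha
    simpa using ha
  · intro a _ b _ h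
    exact Subtype.ext h

lemma sum_prod_add {α β : Type*} [Fintype α] [Fintype β] (c : α → ℝ) (d : β → ℝ) :
    ∑ v : α × β, (c v.1 + d v.2) = Fintype.card β * ∑ a, c a + Fintype.card α * ∑ b, d b := by
  rw [Fintype.sum_prod_type]
  simp only [Finset.sum_add_distrib, Finset.sum_const, Finset.card_univ, nsmul_eq_mul,
    ← Finset.mul_sum]

lemma sum_slotCount_le (f : Sym2 (Fin n)) (hAB : A.card + B.card = n) :
    ∑ v, slotCount A B f v ≤ 2 * n := by
  have h1 : ∀ C : Finset (Fin n),
      ((Finset.univ.filter (fun a : C => (a : Fin n) ∈ f)).card : ℝ) ≤ 2 := fun C => by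
    exact_mod_cast card_filter_coe_mem_sym2_le C f
  have h2 : ∑ v, slotCount A B f v
      = B.card * ((Finset.univ.filter (fun a : A => (a : Fin n) ∈ f)).card : ℝ)
        + A.card * ((Finset.univ.filter (fun a : B => (a : Fin n) ∈ f)).card : ℝ) := by
    have h := sum_prod_add (fun a : A => if (a : Fin n) ∈ f then (1 : ℝ) else 0)
      (fun b : B => if (b : Fin n) ∈ f then (1 : ℝ) else 0)
    rw [Finset.sum_boole, Finset.sum_boole, Fintype.card_coe, Fintype.card_coe] at h
    exact h
  have h3 : (n : ℝ) = A.card + B.card := by exact_mod_cast hAB.symm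
  rw [h2, h3]
  have h4 := mul_le_mul_of_nonneg_left (h1 A) (Nat.cast_nonneg B.card : (0 : ℝ) ≤ _)
  have h5 := mul_le_mul_of_nonneg_left (h1 B) (Nat.cast_nonneg A.card : (0 : ℝ) ≤ _)
  linarith

lemma sum_boxEdges_le (f : Sym2 (Fin n)) {F : A × B → ℝ} (hF : ∀ v, 0 ≤ F v) :
    ∑ m ∈ boxEdges A B f, ∑ v ∈ Finset.univ.filter (· ∈ m), F v
      ≤ ∑ v, slotCount A B f v * F v := by
  rw [Finset.sum_comm' (t' := Finset.univ)
    (s' := fun v => (boxEdges A B f).filter (v ∈ ·)) (by intro m v; simp)]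
  apply Finset.sum_le_sum
  intro v _
  rw [Finset.sum_const, nsmul_eq_mul]
  apply mul_le_mul_of_nonneg_right _ (hF v)
  refine le_trans ?_ (card_nbrs_defectBox_singleton_le A B f v)
  have : (boxEdges A B f).filter (v ∈ ·) ⊆ (nbrs (defectBox A B {f}) v).image (s(v, ·)) := by
    intro m hm
    rw [Finset.mem_filter, mem_boxEdges] at hm
    obtain ⟨w, rfl⟩ := Sym2.mem_iff_exists.1 hm.2
    rw [Finset.mem_image]
    exact ⟨w, mem_nbrs.2 hm.1, rfl⟩
  exact_mod_cast (Finset.card_le_card this).trans Finset.card_image_le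

lemma le_card_boxEdges {e : Sym2 (Fin n)} (he : e ∈ defectSlots A B) :
    min A.card B.card ≤ (boxEdges A B e).card := by
  induction e with
  | _ x y =>
  have hd := not_isDiag_of_mem_defectSlots he
  have hne : x ≠ y := by simpa using hd
  simp only [defectSlots, pairsIn, Finset.mem_union, Finset.mem_filter, Finset.mk_mem_sym2_iff]
    at he
  rcases he with he | he
  · obtain ⟨⟨hx, hy⟩, -⟩ := he
    refine (min_le_right _ _).trans ?_
    rw [← Fintype.card_coe B, ← Finset.card_univ]
    apply Finset.card_le_card_of_injOn
      (fun b => s(((⟨x, hx⟩ : A), b), ((⟨y, hy⟩ : A), b)))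
    · intro b _
      rw [Finset.mem_coe, mem_boxEdges, SimpleGraph.mem_edgeSet, defectBox_adj]
      simp [hne]
    · intro b _ b' _ h
      simp only [Sym2.eq_iff, Prod.mk.injEq] at h
      tauto
  · obtain ⟨⟨hx, hy⟩, -⟩ := he
    refine (min_le_left _ _).trans ?_
    rw [← Fintype.card_coe A, ← Finset.card_univ]
    apply Finset.card_le_card_of_injOn
      (fun a => s((a, (⟨x, hx⟩ : B)), (a, (⟨y, hy⟩ : B))))
    · intro b _
      rw [Finset.mem_coe, mem_boxEdges, SimpleGraph.mem_edgeSet, defectBox_adj]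
      simp [hne]
    · intro b _ b' _ h
      simp only [Sym2.eq_iff, Prod.mk.injEq] at h
      tauto

/-! ### Update probabilities of the defect dynamics -/

/-- The effect on the log partition function of the product graph of adding `e` to `X`. -/
noncomputable def logRatio (lam : ℝ) (X : Finset (Sym2 (Fin n))) (e : Sym2 (Fin n)) : ℝ :=
  Real.log (hardcoreZ (defectBox A B (insert e X)) lam)
    - Real.log (hardcoreZ (defectBox A B X) lam)

/-- A bound for the change of `logRatio` at `e` when `f` is added, valid whenever all defect edges
after the addition, apart from `e`, lie in `Y`. The kernel `influence` uses the product graph of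
`Y` alone and so does not depend on `e`, which makes the sum over `e` easy. -/
noncomputable def slotInfluence (lam : ℝ) (Y : Finset (Sym2 (Fin n))) (f e : Sym2 (Fin n)) : ℝ :=
  4 * lam ^ 3 * ∑ v, slotCount A B f v *
    influence (defectBox A B Y) lam (slotCount A B e) (Fintype.card (A × B) + 1) v

lemma slotInfluence_nonneg {lam : ℝ} (hl : 0 < lam) (Y : Finset (Sym2 (Fin n)))
    (f e : Sym2 (Fin n)) : 0 ≤ slotInfluence A B lam Y f e :=
  mul_nonneg (by positivity) (Finset.sum_nonneg fun v _ => mul_nonneg (slotCount_nonneg A B f v)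
    (influence_nonneg _ hl (slotCount_nonneg A B e) _ v))

lemma abs_logRatio_sub_le {lam : ℝ} (hl : 0 < lam) (hl2 : lam ≤ 1 / 2)
    {X Y : Finset (Sym2 (Fin n))} {e f : Sym2 (Fin n)} (hef : e ≠ f) (hf : f ∉ X)
    (hXY : insert f X ⊆ Y) :
    |logRatio A B lam X e - logRatio A B lam (insert f X) e| ≤ slotInfluence A B lam Y f e := by
  have h := abs_second_difference_le (H := defectBox A B X) (H' := defectBox A B (insert e X))
    (K := defectBox A B Y) hl hl2 (s := slotCount A B e)
    (defectBox_mono A B (Finset.subset_insert _ _)) (card_nbrs_insert_sdiff_le A B X e)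
    (boxEdges A B f) (by rw [← defectBox_insert]; exact defectBox_mono A B hXY)
    (boxEdges_disjoint A B (by simp [hf, Ne.symm hef]))
  rw [← defectBox_insert, ← defectBox_insert] at h
  simp only [indepSum_univ] at h
  have h2 := mul_le_mul_of_nonneg_left (sum_boxEdges_le A B f (F := influence (defectBox A B Y) lam
    (slotCount A B e) (Fintype.card (A × B) + 1))
    (influence_nonneg _ hl (slotCount_nonneg A B e) _)) (show 0 ≤ 4 * lam ^ 3 by positivity)
  have h3 := h.trans h2
  rw [Finset.insert_comm f e] at h3
  unfold logRatio slotInfluence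
  refine (le_of_eq ?_).trans h3
  congr 1
  ring

lemma sum_slotInfluence_le {lam : ℝ} (hl : 0 < lam) (hAB : A.card + B.card = n)
    (E Y : Finset (Sym2 (Fin n))) (f : Sym2 (Fin n))
    (hdeg : ∀ u, lam * (edgeDeg Y u : ℝ) ≤ 1 / 4) :
    ∑ e ∈ E, slotInfluence A B lam Y f e ≤ 32 * lam ^ 3 * (n : ℝ) ^ 2 := by
  unfold slotInfluence
  rw [← Finset.mul_sum, Finset.sum_comm]
  simp only [← Finset.mul_sum]
  have hd : ∀ v, lam * ((nbrs (defectBox A B Y) v).card : ℝ) ≤ 1 / 2 := by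
    intro v
    have h1 : ((nbrs (defectBox A B Y) v).card : ℝ) ≤ edgeDeg Y v.1 + edgeDeg Y v.2 := by
      exact_mod_cast card_nbrs_defectBox_le A B Y v
    have h2 := mul_le_mul_of_nonneg_left h1 hl.le
    linarith [hdeg v.1, hdeg v.2]
  have h1 : ∑ v, slotCount A B f v * ∑ e ∈ E, influence (defectBox A B Y) lam (slotCount A B e)
      (Fintype.card (A × B) + 1) v ≤ ∑ v, slotCount A B f v * (2 * (2 * n)) := by
    apply Finset.sum_le_sum
    intro v _
    apply mul_le_mul_of_nonneg_left _ (slotCount_nonneg A B f v)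
    exact sum_influence_le E _ hl _ (sum_slotCount_slots_le A B E) (by positivity) hd _ v
  rw [← Finset.sum_mul] at h1
  have h2 := mul_le_mul_of_nonneg_right (sum_slotCount_le A B f hAB)
    (show (0 : ℝ) ≤ 2 * (2 * n) by positivity)
  have h3 := mul_le_mul_of_nonneg_left (h1.trans h2) (show 0 ≤ 4 * lam ^ 3 by positivity)
  linarith

lemma logRatio_le {lam : ℝ} (hl : 0 < lam) {X : Finset (Sym2 (Fin n))} {e : Sym2 (Fin n)}
    (he : e ∈ defectSlots A B) (heX : e ∉ X) {d : ℝ}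
    (hdeg : ∀ u, (edgeDeg (insert e X) u : ℝ) ≤ d) (hd : lam * (4 * d + 2) ≤ 1 / 2) :
    logRatio A B lam X e ≤ -(min A.card B.card : ℕ) * (lam ^ 2 / 2) := by
  have h := log_indepSum_sup_fromEdgeSet_le (H := defectBox A B X) (d := 2 * d) hl
    (boxEdges A B e) (boxEdges_disjoint A B heX) (fun v => by
      rw [← defectBox_insert]
      have h1 : ((nbrs (defectBox A B (insert e X)) v).card : ℝ)
          ≤ edgeDeg (insert e X) v.1 + edgeDeg (insert e X) v.2 := by
        exact_mod_cast card_nbrs_defectBox_le A B (insert e X) v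
      linarith [hdeg v.1, hdeg v.2]) (by linarith)
  rw [← defectBox_insert, indepSum_univ, indepSum_univ] at h
  have h2 : ((min A.card B.card : ℕ) : ℝ) ≤ (boxEdges A B e).card := by
    exact_mod_cast le_card_boxEdges A B he
  have h3 := mul_le_mul_of_nonneg_right h2 (show 0 ≤ lam ^ 2 / 2 by positivity)
  unfold logRatio
  linarith

end DefectBox

section DefectChain

variable {n : ℕ} {A B : Finset (Fin n)} {lam : ℝ}

lemma hardcoreZ_pos {V : Type*} [Fintype V] (G : SimpleGraph V) (hl : 0 < lam) :
    0 < hardcoreZ G lam := by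
  rw [← indepSum_univ]
  exact indepSum_pos G hl _

lemma defectWeight_pos (hl : 0 < lam) (X : Finset (Sym2 (Fin n))) :
    0 < defectWeight A B lam X :=
  mul_pos (pow_pos hl _) (hardcoreZ_pos _ hl)

lemma empty_mem_defectSets (hl : 0 < lam) : ∅ ∈ defectSets A B lam := by
  rw [mem_defectSets hl]
  refine ⟨by simp, ?_, by simp [edgeDeg]⟩
  have : graphOf (∅ : Finset (Sym2 (Fin n))) = ⊥ := by simp [graphOf]
  rw [this]
  exact SimpleGraph.cliqueFree_bot (by norm_num)

lemma sum_defectWeight_pos (hl : 0 < lam) :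
    0 < ∑ Y ∈ defectSets A B lam, defectWeight A B lam Y :=
  Finset.sum_pos (fun X _ => defectWeight_pos hl X) ⟨∅, empty_mem_defectSets hl⟩

lemma defectDist_nonneg (hl : 0 < lam) (X : Finset (Sym2 (Fin n))) :
    0 ≤ defectDist A B lam X := by
  unfold defectDist
  split_ifs
  · exact div_nonneg (defectWeight_pos hl X).le (sum_defectWeight_pos hl).le
  · exact le_rfl

lemma defectDist_eq_zero {X : Finset (Sym2 (Fin n))} (hX : X ∉ defectSets A B lam) :
    defectDist A B lam X = 0 := if_neg hX

lemma sum_defectDist (hl : 0 < lam) : ∑ X, defectDist A B lam X = 1 := by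
  unfold defectDist
  rw [← Finset.sum_filter, Finset.filter_mem_eq_inter, Finset.univ_inter, ← Finset.sum_div]
  exact div_self (sum_defectWeight_pos hl).ne'

lemma condMarginal_defectDist (hl : 0 < lam) {X : Finset (Sym2 (Fin n))} {e : Sym2 (Fin n)}
    (he : e ∉ X) (hX : insert e X ∈ defectSets A B lam) :
    condMarginal (defectDist A B lam) X e
      = lam * Real.exp (logRatio A B lam X e) / (1 + lam * Real.exp (logRatio A B lam X e)) := by
  have hX0 := subset_mem_defectSets hl hX (Finset.subset_insert e X)
  have h1 := hardcoreZ_pos (defectBox A B (insert e X)) hl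
  have h2 := hardcoreZ_pos (defectBox A B X) hl
  have h3 := sum_defectWeight_pos (A := A) (B := B) hl
  unfold condMarginal logRatio
  rw [Finset.erase_eq_of_notMem he, Real.exp_sub, Real.exp_log h1, Real.exp_log h2]
  unfold defectDist
  rw [if_pos hX, if_pos hX0, ← add_div, div_div_div_cancel_right₀ h3.ne']
  unfold defectWeight
  rw [Finset.card_insert_of_notMem he, pow_succ]
  have h4 : 0 < lam ^ X.card := pow_pos hl _
  have h5 : lam ^ X.card * lam * hardcoreZ (defectBox A B (insert e X)) lam
      + lam ^ X.card * hardcoreZ (defectBox A B X) lam ≠ 0 := by positivity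
  have h6 : 1 + lam * (hardcoreZ (defectBox A B (insert e X)) lam
      / hardcoreZ (defectBox A B X) lam) ≠ 0 := by positivity
  field_simp
  ring

lemma abs_div_one_add_sub_le {x y : ℝ} (hx : 0 ≤ x) (hy : 0 ≤ y) :
    |x / (1 + x) - y / (1 + y)| ≤ |x - y| := by
  have h : x / (1 + x) - y / (1 + y) = (x - y) / ((1 + x) * (1 + y)) := by
    field_simp
    ring
  rw [h, abs_div, abs_of_pos (by positivity : 0 < (1 + x) * (1 + y))]
  apply div_le_self (abs_nonneg _)
  nlinarith [mul_nonneg hx hy]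

lemma abs_exp_sub_exp_le {x y c : ℝ} (hx : x ≤ c) (hy : y ≤ c) :
    |Real.exp x - Real.exp y| ≤ Real.exp c * |x - y| := by
  have h := abs_exp_neg_sub_exp_neg_le (sub_nonneg.2 hx) (sub_nonneg.2 hy)
  have h1 : Real.exp x - Real.exp y
      = Real.exp c * (Real.exp (-(c - x)) - Real.exp (-(c - y))) := by
    rw [mul_sub, ← Real.exp_add, ← Real.exp_add]
    congr 2 <;> ring
  rw [h1, abs_mul, abs_of_pos (Real.exp_pos c)]
  apply mul_le_mul_of_nonneg_left _ (Real.exp_pos c).le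
  rwa [show c - x - (c - y) = -(x - y) by ring, abs_neg] at h

lemma defectAlpha_pos : 0 < defectAlpha := by unfold defectAlpha; positivity

lemma defectAlpha_le : defectAlpha ≤ 1 / 96 := by
  unfold defectAlpha
  have h : (1 : ℝ) ≤ Real.exp 1 ^ 3 := one_le_pow₀ (Real.one_le_exp zero_le_one)
  apply one_div_le_one_div_of_le (by norm_num)
  linarith

lemma lam_mul_edgeDeg_le (hl : 0 < lam) {X : Finset (Sym2 (Fin n))}
    (hX : X ∈ defectSets A B lam) (u : Fin n) : lam * edgeDeg X u ≤ defectAlpha := by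
  have h1 : (edgeDeg X u : ℝ) ≤ defectAlpha / lam :=
    (Nat.le_floor_iff (div_nonneg defectAlpha_pos.le hl.le)).1 (((mem_defectSets hl).1 hX).2.2 u)
  rw [le_div_iff₀ hl] at h1
  linarith

/-- The bound for the conditional probability that a pair is a defect edge. -/
noncomputable def slotProb (n : ℕ) (lam : ℝ) : ℝ := lam * Real.exp (-(lam ^ 2 * n / 5))

lemma slotProb_nonneg (hl : 0 < lam) : 0 ≤ slotProb n lam := by unfold slotProb; positivity

lemma slotProb_le (hl : 0 < lam) : slotProb n lam ≤ lam := by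
  unfold slotProb
  have : Real.exp (-(lam ^ 2 * n / 5)) ≤ 1 := Real.exp_le_one_iff.2 (by
    have : 0 ≤ lam ^ 2 * n / 5 := by positivity
    linarith)
  nlinarith

lemma WeaklyBalanced.card_add_card (h : WeaklyBalanced A B) : A.card + B.card = n := by
  rw [← Finset.card_union_of_disjoint h.disjoint, h.union_eq, Finset.card_univ, Fintype.card_fin]

lemma WeaklyBalanced.le_min_card (h : WeaklyBalanced A B) :
    2 / 5 * (n : ℝ) ≤ (min A.card B.card : ℕ) := by
  have h1 : (A.card : ℝ) + B.card = n := by exact_mod_cast h.card_add_card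
  have h2 := abs_le.1 h.balance
  have hn : (0 : ℝ) ≤ n := Nat.cast_nonneg n
  rw [Nat.cast_min, le_min_iff]
  constructor <;> linarith [h2.1, h2.2]

lemma logRatio_le_of_mem (hAB : WeaklyBalanced A B) (hl : 0 < lam) (hlα : lam ≤ defectAlpha)
    {X : Finset (Sym2 (Fin n))} {e : Sym2 (Fin n)} (he : e ∉ X)
    (hX : insert e X ∈ defectSets A B lam) :
    logRatio A B lam X e ≤ -(lam ^ 2 * n / 5) := by
  have h := logRatio_le A B hl (((mem_defectSets hl).1 hX).1 (Finset.mem_insert_self _ _)) he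
    (d := defectAlpha / lam)
    (fun u => by
      have := lam_mul_edgeDeg_le hl hX u
      rw [le_div_iff₀ hl]; linarith)
    (by
      have : lam * (4 * (defectAlpha / lam) + 2) = 4 * defectAlpha + 2 * lam := by field_simp
      rw [this]
      linarith [defectAlpha_le])
  have h2 := mul_le_mul_of_nonneg_right hAB.le_min_card (show 0 ≤ lam ^ 2 / 2 by positivity)
  linarith

lemma condMarginal_defectDist_le (hAB : WeaklyBalanced A B) (hl : 0 < lam)
    (hlα : lam ≤ defectAlpha) (X : Finset (Sym2 (Fin n))) (e : Sym2 (Fin n)) :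
    condMarginal (defectDist A B lam) X e ≤ slotProb n lam := by
  by_cases hX : insert e X ∈ defectSets A B lam
  · rw [← condMarginal_erase_self]
    have he : e ∉ X.erase e := by simp
    rw [← insert_erase_self_eq] at hX
    rw [condMarginal_defectDist hl he hX]
    have h1 := Real.exp_le_exp.2 (logRatio_le_of_mem hAB hl hlα he hX)
    have h2 := Real.exp_pos (logRatio A B lam (X.erase e) e)
    refine (div_le_self (by positivity) (by nlinarith)).trans ?_
    exact mul_le_mul_of_nonneg_left h1 hl.le
  · rw [condMarginal_eq_zero (fun Y hY => defectDist_eq_zero hY) hX]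
    exact slotProb_nonneg hl

/-- The update probabilities in two neighbouring states are close when both states admit the
updated pair. -/
lemma abs_condMarginal_sub_le (hAB : WeaklyBalanced A B) (hl : 0 < lam) (hlα : lam ≤ defectAlpha)
    {X : Finset (Sym2 (Fin n))} {e f : Sym2 (Fin n)} (hef : e ≠ f) (hf : f ∉ X)
    (hX : insert e (insert f X) ∈ defectSets A B lam) :
    |condMarginal (defectDist A B lam) X e - condMarginal (defectDist A B lam) (insert f X) e|
      ≤ slotProb n lam * slotInfluence A B lam (insert f X) f e := by
  rw [← condMarginal_erase_self _ X, ← condMarginal_erase_self _ (insert f X),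
    Finset.erase_insert_of_ne (Ne.symm hef)]
  set X0 := X.erase e with hX0
  have he : e ∉ X0 := by simp [hX0]
  have hf0 : f ∉ X0 := fun h => hf (Finset.mem_of_mem_erase h)
  have he' : e ∉ insert f X0 := by simp [he, hef]
  have hYX : insert f X0 ⊆ insert f X :=
    Finset.insert_subset_insert _ (Finset.erase_subset _ _)
  have hY0 : insert e (insert f X0) ∈ defectSets A B lam :=
    subset_mem_defectSets hl hX (Finset.insert_subset_insert _ hYX)
  have hX0' : insert e X0 ∈ defectSets A B lam :=
    subset_mem_defectSets hl hY0 (Finset.insert_subset_insert _ (Finset.subset_insert _ _))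
  rw [condMarginal_defectDist hl he hX0', condMarginal_defectDist hl he' hY0]
  refine (abs_div_one_add_sub_le (by positivity) (by positivity)).trans ?_
  rw [← mul_sub, abs_mul, abs_of_pos hl]
  have h1 := abs_exp_sub_exp_le (logRatio_le_of_mem hAB hl hlα he hX0')
    (logRatio_le_of_mem hAB hl hlα he' hY0)
  have h2 := abs_logRatio_sub_le A B hl (by linarith [defectAlpha_le]) hef hf0 hYX
  have h3 := mul_le_mul_of_nonneg_left h2 (Real.exp_pos (-(lam ^ 2 * n / 5))).le
  have h4 := mul_le_mul_of_nonneg_left (h1.trans h3) hl.le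
  unfold slotProb
  linarith

/-! ### Blocked updates -/

open Classical in
/-- The pairs that complete a triangle together with `f` and a pair of `X`. -/
noncomputable def triangleClosing (X : Finset (Sym2 (Fin n))) (f : Sym2 (Fin n)) :
    Finset (Sym2 (Fin n)) :=
  Finset.univ.filter fun e => ∃ u v w, f = s(u, v) ∧ e = s(u, w) ∧ s(v, w) ∈ X

lemma card_triangleClosing_le {X : Finset (Sym2 (Fin n))} (f : Sym2 (Fin n)) {D : ℕ}
    (hD : ∀ u, edgeDeg X u ≤ D) : (triangleClosing X f).card ≤ 2 * D := by
  induction f with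
  | _ x y =>
  have hcard : ∀ v, (Finset.univ.filter (fun w => s(v, w) ∈ X)).card ≤ D := by
    intro v
    refine le_trans ?_ (hD v)
    apply Finset.card_le_card_of_injOn (fun w => s(v, w))
    · intro w hw
      simpa using hw
    · intro w _ w' _ h
      exact Sym2.congr_right.1 h
  have hsub : triangleClosing X s(x, y)
      ⊆ (Finset.univ.filter (fun w => s(y, w) ∈ X)).image (fun w => s(x, w))
        ∪ (Finset.univ.filter (fun w => s(x, w) ∈ X)).image (fun w => s(y, w)) := by
    intro e he
    simp only [triangleClosing, Finset.mem_filter, Finset.mem_univ, true_and] at he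
    obtain ⟨u, v, w, hf, rfl, hvw⟩ := he
    rw [Sym2.eq_iff] at hf
    simp only [Finset.mem_union, Finset.mem_image, Finset.mem_filter, Finset.mem_univ, true_and]
    rcases hf with ⟨rfl, rfl⟩ | ⟨rfl, rfl⟩
    · exact Or.inl ⟨w, hvw, rfl⟩
    · exact Or.inr ⟨w, hvw, rfl⟩
  have h1 := (Finset.card_le_card hsub).trans (Finset.card_union_le _ _)
  have h2 := (Finset.card_image_le (s := Finset.univ.filter (fun w => s(y, w) ∈ X))
    (f := fun w => s(x, w))).trans (hcard y)
  have h3 := (Finset.card_image_le (s := Finset.univ.filter (fun w => s(x, w) ∈ X))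
    (f := fun w => s(y, w))).trans (hcard x)
  omega

lemma not_cliqueFree_three_iff {X : Finset (Sym2 (Fin n))} :
    ¬ (graphOf X).CliqueFree 3 ↔ ∃ a b c, a ≠ b ∧ a ≠ c ∧ b ≠ c ∧
      s(a, b) ∈ X ∧ s(a, c) ∈ X ∧ s(b, c) ∈ X := by
  simp only [SimpleGraph.CliqueFree, not_forall, not_not, SimpleGraph.is3Clique_iff, graphOf_adj]
  constructor
  · rintro ⟨_, a, b, c, h1, h2, h3, _⟩
    exact ⟨a, b, c, h1.2, h2.2, h3.2, h1.1, h2.1, h3.1⟩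
  · rintro ⟨a, b, c, h1, h2, h3, h4, h5, h6⟩
    exact ⟨_, a, b, c, ⟨h4, h1⟩, ⟨h5, h2⟩, ⟨h6, h3⟩, rfl⟩

lemma mem_triangleClosing_of_not_cliqueFree {X : Finset (Sym2 (Fin n))} {e f : Sym2 (Fin n)}
    (he : (graphOf (insert e X)).CliqueFree 3) (hf : (graphOf (insert f X)).CliqueFree 3)
    (hef : ¬ (graphOf (insert e (insert f X))).CliqueFree 3) : e ∈ triangleClosing X f := by
  have key : ∀ a b c : Fin n, a ≠ b → a ≠ c → b ≠ c → e = s(a, b) → f = s(a, c) →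
      s(b, c) ∈ insert e (insert f X) → e ∈ triangleClosing X f := by
    intro a b c hab hac hbc h1 h2 h3
    simp only [triangleClosing, Finset.mem_filter, Finset.mem_univ, true_and]
    refine ⟨a, c, b, h2, h1, ?_⟩
    rw [Sym2.eq_swap]
    simp only [Finset.mem_insert, h1, h2, Sym2.eq_iff] at h3
    rcases h3 with (h | h) | (h | h) | h
    · exact absurd h.1.symm hab
    · exact absurd h.2.symm hac
    · exact absurd h.1.symm hab
    · exact absurd h.2.symm hac
    · exact h
  rw [not_cliqueFree_three_iff] at hef
  obtain ⟨a, b, c, hab, hac, hbc, h1, h2, h3⟩ := hef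
  have he' : ¬ (s(a, b) ∈ insert e X ∧ s(a, c) ∈ insert e X ∧ s(b, c) ∈ insert e X) :=
    fun h => not_cliqueFree_three_iff.2 ⟨a, b, c, hab, hac, hbc, h⟩ he
  have hf' : ¬ (s(a, b) ∈ insert f X ∧ s(a, c) ∈ insert f X ∧ s(b, c) ∈ insert f X) :=
    fun h => not_cliqueFree_three_iff.2 ⟨a, b, c, hab, hac, hbc, h⟩ hf
  have k1 := key a b c hab hac hbc
  have k2 := key b a c hab.symm hbc hac
  have k3 := key a c b hac hab hbc.symm
  have k4 := key c a b hac.symm hbc.symm hab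
  have k5 := key b c a hbc hab.symm hac.symm
  have k6 := key c b a hbc.symm hac.symm hab.symm
  rw [Sym2.eq_swap (a := b) (b := a)] at k2 k5
  rw [Sym2.eq_swap (a := c) (b := b)] at k3 k6
  rw [Sym2.eq_swap (a := c) (b := a)] at k4 k5 k6
  simp only [Finset.mem_insert] at *
  grind

/-- If `e` may be added to `X` but not to `insert f X`, then it closes a triangle through `f`, or
it shares with `f` a vertex at which `X` is within one of the degree bound. -/
lemma mem_triangleClosing_or_of_notMem (hl : 0 < lam) {X : Finset (Sym2 (Fin n))}
    {e f : Sym2 (Fin n)} (heX : e ∉ insert f X) (hfX : f ∉ X)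
    (hX : insert e X ∈ defectSets A B lam) (hY : insert f X ∈ defectSets A B lam)
    (h : insert e (insert f X) ∉ defectSets A B lam) :
    e ∈ triangleClosing X f ∨
      ∃ u, u ∈ f ∧ u ∈ e ∧ ⌊defectAlpha / lam⌋₊ ≤ edgeDeg X u + 1 := by
  rw [mem_defectSets hl] at hX hY h
  by_contra hcon
  push Not at hcon
  obtain ⟨h1, h2⟩ := hcon
  apply h
  refine ⟨?_, ?_, ?_⟩
  · exact Finset.insert_subset (hX.1 (Finset.mem_insert_self _ _)) hY.1
  · by_contra h3
    exact h1 (mem_triangleClosing_of_not_cliqueFree hX.2.1 hY.2.1 h3)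
  · intro u
    have a1 := hX.2.2 u
    have a2 := hY.2.2 u
    have a3 := h2 u
    have heX' : e ∉ X := fun h => heX (Finset.mem_insert_of_mem h)
    rw [edgeDeg_insert heX]
    rw [edgeDeg_insert heX'] at a1
    rw [edgeDeg_insert hfX] at a2 ⊢
    split_ifs at * <;> grind

end DefectChain

/-! ### Contraction of the degree-weighted distance -/

section Contraction

variable {n : ℕ} {A B : Finset (Fin n)} {lam : ℝ}

/-- The penalty for the degree of `u`: it doubles with each edge at `u` and reaches `1 / 2` one
edge below the degree bound `D`. -/
noncomputable def degPenalty (D : ℕ) (X : Finset (Sym2 (Fin n))) (u : Fin n) : ℝ :=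
  2 ^ edgeDeg X u / 2 ^ D

/-- The weight of the step from `X` to `insert f X`. -/
noncomputable def stepWeight (D : ℕ) (X : Finset (Sym2 (Fin n))) (f : Sym2 (Fin n)) : ℝ :=
  1 + ∑ u ∈ Finset.univ.filter (· ∈ f), degPenalty D X u

lemma degPenalty_nonneg (D : ℕ) (X : Finset (Sym2 (Fin n))) (u : Fin n) :
    0 ≤ degPenalty D X u := by unfold degPenalty; positivity

lemma one_le_stepWeight (D : ℕ) (X : Finset (Sym2 (Fin n))) (f : Sym2 (Fin n)) :
    1 ≤ stepWeight D X f :=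
  le_add_of_nonneg_right (Finset.sum_nonneg fun u _ => degPenalty_nonneg D X u)

lemma degPenalty_le_half {D : ℕ} {X : Finset (Sym2 (Fin n))} {u : Fin n}
    (h : edgeDeg X u + 1 ≤ D) : degPenalty D X u ≤ 1 / 2 := by
  unfold degPenalty
  rw [div_le_div_iff₀ (by positivity) (by norm_num)]
  have : (2 : ℝ) ^ (edgeDeg X u + 1) ≤ 2 ^ D := pow_le_pow_right₀ (by norm_num) h
  rw [pow_succ] at this
  linarith

lemma edgeDeg_add_one_le (hl : 0 < lam) {X : Finset (Sym2 (Fin n))} {f : Sym2 (Fin n)}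
    (hf : f ∉ X) (hX : insert f X ∈ defectSets A B lam) {u : Fin n} (hu : u ∈ f) :
    edgeDeg X u + 1 ≤ ⌊defectAlpha / lam⌋₊ := by
  have := ((mem_defectSets hl).1 hX).2.2 u
  rwa [edgeDeg_insert hf, if_pos hu] at this

lemma stepWeight_le_two (hl : 0 < lam) {X : Finset (Sym2 (Fin n))} {f : Sym2 (Fin n)}
    (hf : f ∉ X) (hX : insert f X ∈ defectSets A B lam) :
    stepWeight ⌊defectAlpha / lam⌋₊ X f ≤ 2 := by
  unfold stepWeight
  have h : ∑ u ∈ Finset.univ.filter (· ∈ f), degPenalty ⌊defectAlpha / lam⌋₊ X u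
      ≤ (Finset.univ.filter (fun u : Fin n => u ∈ f)).card • (1 / 2 : ℝ) := by
    apply Finset.sum_le_card_nsmul
    intro u hu
    exact degPenalty_le_half (edgeDeg_add_one_le hl hf hX (by simpa using hu))
  have h2 : ((Finset.univ.filter (fun u : Fin n => u ∈ f)).card : ℝ) ≤ 2 := by
    exact_mod_cast card_filter_mem_sym2_le f
  rw [nsmul_eq_mul] at h
  linarith

lemma degPenalty_insert (D : ℕ) {X : Finset (Sym2 (Fin n))} {e : Sym2 (Fin n)} (he : e ∉ X)
    (u : Fin n) : degPenalty D (insert e X) u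
      = degPenalty D X u + if u ∈ e then degPenalty D X u else 0 := by
  unfold degPenalty
  rw [edgeDeg_insert he]
  split_ifs
  · rw [pow_succ]; ring
  · simp

/-- The expected increase of the weight of the step along `f` when `e` is resampled, and the
expected weight of a new disagreement at `e`. -/
lemma coupledWeight_le (hAB : WeaklyBalanced A B) (hl : 0 < lam) (hlα : lam ≤ defectAlpha)
    {X : Finset (Sym2 (Fin n))} {e f : Sym2 (Fin n)} (hef : e ≠ f) (hf : f ∉ X)
    (hX : insert f X ∈ defectSets A B lam) :
    coupledWeight (defectDist A B lam) (stepWeight ⌊defectAlpha / lam⌋₊) X f e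
      ≤ stepWeight ⌊defectAlpha / lam⌋₊ X f
        + ∑ u ∈ Finset.univ.filter (· ∈ f),
          ((if u ∈ e then slotProb n lam * degPenalty ⌊defectAlpha / lam⌋₊ X u
            + 2 * slotProb n lam * (if ⌊defectAlpha / lam⌋₊ ≤ edgeDeg X u + 1 then 1 else 0)
            else 0)
          - (if u ∈ e ∧ e ∈ X then degPenalty ⌊defectAlpha / lam⌋₊ X u / 4 else 0))
        + 2 * slotProb n lam * slotInfluence A B lam (insert f X) f e
        + 2 * slotProb n lam * (if e ∈ triangleClosing X f then 1 else 0) := by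
  set D := ⌊defectAlpha / lam⌋₊ with hD
  set q := slotProb n lam with hq
  set ν := defectDist A B lam with hν
  have hq0 : 0 ≤ q := slotProb_nonneg hl
  have hq1 : q ≤ 1 / 2 := (slotProb_le hl).trans (by linarith [defectAlpha_le])
  have hI := slotInfluence_nonneg A B hl (insert f X) f e
  have hp0 := condMarginal_nonneg (defectDist_nonneg (A := A) (B := B) hl) (insert f X) e
  have hpq := condMarginal_defectDist_le hAB hl hlα (insert f X) e
  rw [← hν] at hp0 hpq
  have hpe : |condMarginal ν X e - condMarginal ν (insert f X) e| ≤ q := by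
    have h1 := condMarginal_nonneg (defectDist_nonneg (A := A) (B := B) hl) X e
    have h2 := condMarginal_defectDist_le hAB hl hlα X e
    rw [abs_le]
    constructor <;> linarith
  -- The drift of the weight of the step along `f`.
  have hdrift : condMarginal ν (insert f X) e * stepWeight D (insert e X) f
      + (1 - condMarginal ν (insert f X) e) * stepWeight D (X.erase e) f
      ≤ stepWeight D X f + ∑ u ∈ Finset.univ.filter (· ∈ f),
        ((if u ∈ e then q * degPenalty D X u else 0)
          - (if u ∈ e ∧ e ∈ X then degPenalty D X u / 4 else 0)) := by
    set p := condMarginal ν (insert f X) e with hp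
    unfold stepWeight
    rw [mul_add, mul_add, Finset.mul_sum, Finset.mul_sum, add_add_add_comm,
      ← Finset.sum_add_distrib, add_assoc 1, ← Finset.sum_add_distrib]
    apply add_le_add (by linarith)
    apply Finset.sum_le_sum
    intro u _
    have h0 := degPenalty_nonneg D X u
    by_cases he : e ∈ X
    · rw [Finset.insert_eq_of_mem he]
      have h := degPenalty_insert D (X := X.erase e) (e := e) (by simp) u
      rw [Finset.insert_erase he] at h
      by_cases hu : u ∈ e
      · simp only [hu, he, if_true, true_and] at h ⊢
        have : degPenalty D (X.erase e) u = degPenalty D X u / 2 := by linarith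
        rw [this]
        nlinarith [mul_nonneg hq0 h0]
      · simp only [hu, if_false, false_and, add_zero, sub_zero] at h ⊢
        rw [← h]
        linarith
    · rw [Finset.erase_eq_of_notMem he, degPenalty_insert D he u]
      by_cases hu : u ∈ e
      · simp only [hu, he, if_true, and_false, if_false]
        nlinarith [mul_le_mul_of_nonneg_right hpq h0]
      · simp only [hu, if_false, false_and]
        linarith
  -- The cost of a new disagreement at `e`.
  have hnew : |condMarginal ν X e - condMarginal ν (insert f X) e| * stepWeight D (X.erase e) e
      ≤ ∑ u ∈ Finset.univ.filter (· ∈ f),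
        (if u ∈ e then 2 * q * (if D ≤ edgeDeg X u + 1 then 1 else 0) else 0)
        + 2 * q * slotInfluence A B lam (insert f X) f e
        + 2 * q * (if e ∈ triangleClosing X f then 1 else 0) := by
    have hs0 : ∀ u : Fin n,
        0 ≤ (if u ∈ e then 2 * q * (if D ≤ edgeDeg X u + 1 then (1 : ℝ) else 0) else 0) := by
      intro u; split_ifs <;> simp [hq0]
    have hs1 := Finset.sum_nonneg fun u (_ : u ∈ Finset.univ.filter (fun u : Fin n => u ∈ f)) =>
      hs0 u
    have hs2 : 0 ≤ 2 * q * (if e ∈ triangleClosing X f then (1 : ℝ) else 0) := by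
      split_ifs <;> simp [hq0]
    have hs3 : 0 ≤ 2 * q * slotInfluence A B lam (insert f X) f e := by positivity
    by_cases h1 : insert e X ∈ defectSets A B lam
    · have hw : stepWeight D (X.erase e) e ≤ 2 :=
        stepWeight_le_two hl (by simp) (by rwa [insert_erase_self_eq])
      have hw' := mul_le_mul_of_nonneg_left hw
        (abs_nonneg (condMarginal ν X e - condMarginal ν (insert f X) e))
      by_cases h2 : insert e (insert f X) ∈ defectSets A B lam
      · have := abs_condMarginal_sub_le hAB hl hlα hef hf h2
        rw [← hν, ← hq] at this
        linarith
      · have heX : e ∉ insert f X := fun h => h2 (by rwa [Finset.insert_eq_of_mem h])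
        rcases mem_triangleClosing_or_of_notMem hl heX hf h1 hX h2 with h | ⟨u, huf, hue, hu⟩
        · rw [if_pos h]
          linarith
        · have := Finset.single_le_sum (fun u _ => hs0 u)
            (show u ∈ Finset.univ.filter (fun u : Fin n => u ∈ f) by simpa using huf)
          rw [if_pos hue, if_pos hu] at this
          linarith
    · have h2 : insert e (insert f X) ∉ defectSets A B lam := fun h2 => h1
        (subset_mem_defectSets hl h2 (Finset.insert_subset_insert _ (Finset.subset_insert _ _)))
      rw [hν, condMarginal_eq_zero (fun Y hY => defectDist_eq_zero hY) h1,
        condMarginal_eq_zero (fun Y hY => defectDist_eq_zero hY) h2]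
      simp only [sub_self, abs_zero, zero_mul]
      linarith
  have hsplit : ∑ u ∈ Finset.univ.filter (· ∈ f),
        ((if u ∈ e then q * degPenalty D X u
            + 2 * q * (if D ≤ edgeDeg X u + 1 then 1 else 0) else 0)
          - (if u ∈ e ∧ e ∈ X then degPenalty D X u / 4 else 0))
      = ∑ u ∈ Finset.univ.filter (· ∈ f),
        ((if u ∈ e then q * degPenalty D X u else 0)
          - (if u ∈ e ∧ e ∈ X then degPenalty D X u / 4 else 0))
        + ∑ u ∈ Finset.univ.filter (· ∈ f),
        (if u ∈ e then 2 * q * (if D ≤ edgeDeg X u + 1 then 1 else 0) else 0) := by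
    rw [← Finset.sum_add_distrib]
    apply Finset.sum_congr rfl
    intro u _
    by_cases hu : u ∈ e
    · simp only [hu, if_true]; ring
    · simp only [hu, if_false]; ring
  rw [hsplit, coupledWeight]
  linarith

/-- The drift at one endpoint `u` of `f`. At high degree the removal of the edges at `u` beats
both the growth of the penalty and the cost of blocked updates; at low degree the penalty is too
small to matter. -/
lemma endpoint_drift_le {D : ℕ} {X : Finset (Sym2 (Fin n))} {u : Fin n} {q : ℝ}
    (hu : edgeDeg X u + 1 ≤ D) (hq : 0 ≤ q) (hqD : n * q ≤ D / 100) :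
    n * (q * degPenalty D X u + 2 * q * (if D ≤ edgeDeg X u + 1 then 1 else 0))
      - edgeDeg X u * (degPenalty D X u / 4) ≤ 1 / 10 := by
  have h0 := degPenalty_nonneg D X u
  have hhalf := degPenalty_le_half hu
  have hnq : 0 ≤ n * q := by positivity
  by_cases h1 : D ≤ edgeDeg X u + 1
  · have hDe : D = edgeDeg X u + 1 := le_antisymm h1 hu
    have hh : degPenalty D X u = 1 / 2 := by
      unfold degPenalty
      rw [hDe, pow_succ]
      field_simp
    have hDr : (D : ℝ) = edgeDeg X u + 1 := by exact_mod_cast hDe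
    rw [if_pos h1, hh]
    have : (0 : ℝ) ≤ edgeDeg X u := Nat.cast_nonneg _
    linarith
  · rw [if_neg h1]
    -- `j = D - deg u` satisfies `j * 2 ^ (-j) ≤ 1`.
    have hkey : (D : ℝ) * degPenalty D X u ≤ 2 + edgeDeg X u * degPenalty D X u := by
      have h2 : D = edgeDeg X u + (D - edgeDeg X u) := by omega
      set j := D - edgeDeg X u with hj
      have h3 : (j : ℝ) ≤ 2 ^ j := by exact_mod_cast Nat.lt_two_pow_self.le
      have h4 : degPenalty D X u = 1 / 2 ^ j := by
        unfold degPenalty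
        rw [h2, Nat.add_sub_cancel_left, pow_add] at *
        field_simp
      have h5 : (D : ℝ) = edgeDeg X u + j := by exact_mod_cast h2
      rw [h4, h5]
      have h6 : (j : ℝ) * (1 / 2 ^ j) ≤ 1 := by
        rw [mul_one_div]
        exact div_le_one_of_le₀ h3 (by positivity)
      linarith
    have h7 := mul_le_mul_of_nonneg_right hqD h0
    have h8 : 0 ≤ (edgeDeg X u : ℝ) * degPenalty D X u := by positivity
    linarith

/-- The coupled weights contract by the factor `1 - 1 / (2 N)`, where `N` is the number of
slots. -/
lemma sum_coupledWeight_le (hAB : WeaklyBalanced A B) (hl : 0 < lam) (hlα : lam ≤ defectAlpha)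
    (hq1 : n * slotProb n lam ≤ (⌊defectAlpha / lam⌋₊ : ℝ) / 100)
    (hq2 : slotProb n lam * (64 * lam ^ 3 * (n : ℝ) ^ 2) ≤ 1 / 100)
    {X : Finset (Sym2 (Fin n))} {f : Sym2 (Fin n)} (hf : f ∉ X)
    (hX : insert f X ∈ defectSets A B lam) :
    ∑ e ∈ (defectSlots A B).erase f,
      coupledWeight (defectDist A B lam) (stepWeight ⌊defectAlpha / lam⌋₊) X f e
      ≤ ((defectSlots A B).card : ℝ) *
        ((1 - 1 / (2 * ((defectSlots A B).card : ℝ))) * stepWeight ⌊defectAlpha / lam⌋₊ X f) := by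
  have hsum := Finset.sum_le_sum fun e (he : e ∈ (defectSlots A B).erase f) =>
    coupledWeight_le hAB hl hlα (Finset.mem_erase.1 he).1 hf hX
  refine hsum.trans ?_
  set D := ⌊defectAlpha / lam⌋₊ with hD
  set q := slotProb n lam with hq
  have hq0 : 0 ≤ q := slotProb_nonneg hl
  have hfE : f ∈ defectSlots A B := ((mem_defectSets hl).1 hX).1 (Finset.mem_insert_self _ _)
  have hXE : X ⊆ (defectSlots A B).erase f := fun e he => Finset.mem_erase.2
    ⟨fun h => hf (h ▸ he), ((mem_defectSets hl).1 hX).1 (Finset.mem_insert_of_mem he)⟩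
  have hcard0 : (0 : ℝ) < (defectSlots A B).card := by
    exact_mod_cast Finset.card_pos.2 ⟨f, hfE⟩
  have hcard : (((defectSlots A B).erase f).card : ℝ) = (defectSlots A B).card - 1 := by
    rw [Finset.card_erase_of_mem hfE, Nat.cast_sub (Finset.card_pos.2 ⟨f, hfE⟩)]
    simp
  rw [Finset.sum_add_distrib, Finset.sum_add_distrib, Finset.sum_add_distrib, Finset.sum_const,
    nsmul_eq_mul, hcard, ← Finset.mul_sum, ← Finset.mul_sum, Finset.sum_comm]
  have hI : ∑ e ∈ (defectSlots A B).erase f, slotInfluence A B lam (insert f X) f e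
      ≤ 32 * lam ^ 3 * (n : ℝ) ^ 2 :=
    sum_slotInfluence_le A B hl hAB.card_add_card _ _ f fun u =>
      (lam_mul_edgeDeg_le hl hX u).trans (by linarith [defectAlpha_le])
  have hT : ∑ e ∈ (defectSlots A B).erase f, (if e ∈ triangleClosing X f then (1 : ℝ) else 0)
      ≤ 2 * D := by
    rw [Finset.sum_boole]
    have h1 := card_triangleClosing_le f (((mem_defectSets hl).1
      (subset_mem_defectSets hl hX (Finset.subset_insert f X))).2.2)
    have h2 : (((defectSlots A B).erase f).filter (· ∈ triangleClosing X f)).card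
        ≤ (triangleClosing X f).card :=
      Finset.card_le_card fun e he => (Finset.mem_filter.1 he).2
    exact_mod_cast h2.trans h1
  have hqD : q * D ≤ 1 / 96 := by
    have h1 : (D : ℝ) ≤ defectAlpha / lam :=
      Nat.floor_le (div_nonneg defectAlpha_pos.le hl.le)
    rw [le_div_iff₀ hl] at h1
    have h2 := mul_le_mul_of_nonneg_right (slotProb_le (n := n) hl)
      (Nat.cast_nonneg D : (0 : ℝ) ≤ D)
    linarith [defectAlpha_le]
  have hU : ∑ u ∈ Finset.univ.filter (· ∈ f), ∑ e ∈ (defectSlots A B).erase f,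
      ((if u ∈ e then q * degPenalty D X u
          + 2 * q * (if D ≤ edgeDeg X u + 1 then 1 else 0) else 0)
        - (if u ∈ e ∧ e ∈ X then degPenalty D X u / 4 else 0)) ≤ 1 / 5 := by
    have h1 : ∀ u ∈ Finset.univ.filter (· ∈ f), ∑ e ∈ (defectSlots A B).erase f,
        ((if u ∈ e then q * degPenalty D X u
          + 2 * q * (if D ≤ edgeDeg X u + 1 then 1 else 0) else 0)
        - (if u ∈ e ∧ e ∈ X then degPenalty D X u / 4 else 0)) ≤ 1 / 10 := by
      intro u hu
      have hu' := edgeDeg_add_one_le hl hf hX (by simpa using hu)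
      refine le_trans ?_ (endpoint_drift_le hu' hq0 hq1)
      rw [Finset.sum_sub_distrib, ← Finset.sum_filter, ← Finset.sum_filter, Finset.sum_const,
        Finset.sum_const, nsmul_eq_mul, nsmul_eq_mul]
      have e1 : ((defectSlots A B).erase f).filter (fun e => u ∈ e ∧ e ∈ X)
          = X.filter (u ∈ ·) := by
        ext e
        have := @hXE e
        simp only [Finset.mem_filter]
        tauto
      have e2 : ((((defectSlots A B).erase f).filter (u ∈ ·)).card : ℝ) ≤ n := by
        exact_mod_cast edgeDeg_le ((defectSlots A B).erase f) u
      rw [e1, show (X.filter (u ∈ ·)).card = edgeDeg X u from rfl]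
      apply sub_le_sub_right
      apply mul_le_mul_of_nonneg_right e2
      have := degPenalty_nonneg D X u
      split_ifs <;> positivity
    have h2 := Finset.sum_le_card_nsmul _ _ _ h1
    have h3 : ((Finset.univ.filter (fun u : Fin n => u ∈ f)).card : ℝ) ≤ 2 := by
      exact_mod_cast card_filter_mem_sym2_le f
    rw [nsmul_eq_mul] at h2
    linarith
  have hw := one_le_stepWeight D X f
  have hrhs : ((defectSlots A B).card : ℝ) *
      ((1 - 1 / (2 * ((defectSlots A B).card : ℝ))) * stepWeight D X f)
      = (((defectSlots A B).card : ℝ) - 1) * stepWeight D X f + stepWeight D X f / 2 := by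
    field_simp
    ring
  rw [hrhs]
  have h1 := mul_le_mul_of_nonneg_left hI (show 0 ≤ 2 * q by linarith)
  have h2 := mul_le_mul_of_nonneg_left hT (show 0 ≤ 2 * q by linarith)
  linarith

/-! ### From contraction to the mixing time -/

lemma card_defectSlots_le : (defectSlots A B).card ≤ n ^ 2 := by
  have : defectSlots A B
      ⊆ (Finset.univ : Finset (Fin n × Fin n)).image (fun p => s(p.1, p.2)) := by
    intro e _
    induction e with
    | _ x y => exact Finset.mem_image.2 ⟨(x, y), Finset.mem_univ _, rfl⟩
  refine (Finset.card_le_card this).trans (Finset.card_image_le.trans ?_)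
  simp [pow_two]

lemma mixingTime_le {Ω : Type*} [Fintype Ω] [DecidableEq Ω] {P : Matrix Ω Ω ℝ} {π : Ω → ℝ}
    {S : Finset Ω} {t : ℕ} (h : ∀ x ∈ S, ∃ s ≤ t, tvDist ((P ^ s) x) π < 1 / 4) :
    mixingTime P π S ≤ t := by
  unfold mixingTime
  refine iSup₂_le fun x hx => ?_
  obtain ⟨s, hs, hlt⟩ := h x hx
  exact (iInf₂_le s hlt).trans (by exact_mod_cast hs)

lemma defectSets_eq_singleton_of_floor_eq_zero (hl : 0 < lam)
    (h : ⌊defectAlpha / lam⌋₊ = 0) : defectSets A B lam = {∅} := by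
  ext X
  rw [Finset.mem_singleton]
  refine ⟨fun hX => ?_, fun hX => hX ▸ empty_mem_defectSets hl⟩
  rw [Finset.eq_empty_iff_forall_notMem]
  intro e he
  have h1 := ((mem_defectSets hl).1 hX).2.2 e.out.1
  rw [h, Nat.le_zero, edgeDeg, Finset.card_eq_zero] at h1
  exact Finset.notMem_empty e (h1 ▸ Finset.mem_filter.2 ⟨he, e.out_fst_mem⟩)

lemma defectSets_eq_singleton_of_slots_eq_empty (hl : 0 < lam)
    (h : defectSlots A B = ∅) : defectSets A B lam = {∅} := by
  ext X
  rw [Finset.mem_singleton]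
  refine ⟨fun hX => ?_, fun hX => hX ▸ empty_mem_defectSets hl⟩
  exact Finset.subset_empty.1 (h ▸ ((mem_defectSets hl).1 hX).1)

lemma defectMixingTime_le_of_defectSets_eq_singleton (hl : 0 < lam)
    (hS : defectSets A B lam = {∅}) (t : ℕ) : defectMixingTime A B lam ≤ t := by
  apply mixingTime_le
  intro X hX
  refine ⟨0, Nat.zero_le _, ?_⟩
  rw [hS, Finset.mem_singleton] at hX
  subst hX
  have hν : ∀ X : Finset (Sym2 (Fin n)),
      ((glauberMatrix (defectSlots A B) (defectDist A B lam)) ^ 0) ∅ X = defectDist A B lam X := by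
    intro X
    rw [pow_zero, Matrix.one_apply]
    unfold defectDist
    rw [hS]
    by_cases hX : X = ∅
    · subst hX
      simp [(defectWeight_pos hl ∅).ne']
    · simp [hX, Ne.symm hX]
  unfold tvDist
  simp only [hν, sub_self, abs_zero, Finset.sum_const_zero]
  norm_num

/-- The bound on the mixing time once the drift terms are small. -/
lemma defectMixingTime_le (hn : 2 ≤ n) (hAB : WeaklyBalanced A B) (hl : 0 < lam)
    (hlα : lam ≤ defectAlpha)
    (hq1 : n * slotProb n lam ≤ (⌊defectAlpha / lam⌋₊ : ℝ) / 100)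
    (hq2 : slotProb n lam * (64 * lam ^ 3 * (n : ℝ) ^ 2) ≤ 1 / 100) :
    defectMixingTime A B lam ≤ (⌊21 * (n : ℝ) ^ 2 * Real.log n⌋₊ : ℕ∞) := by
  have hnr : (2 : ℝ) ≤ n := by exact_mod_cast hn
  set D := ⌊defectAlpha / lam⌋₊ with hD
  rcases Finset.eq_empty_or_nonempty (defectSlots A B) with hE | hE
  · exact defectMixingTime_le_of_defectSets_eq_singleton hl
      (defectSets_eq_singleton_of_slots_eq_empty hl hE) _
  set E := defectSlots A B with hEdef
  have hcard0 : (0 : ℝ) < E.card := by exact_mod_cast hE.card_pos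
  have hcard1 : (1 : ℝ) ≤ E.card := by exact_mod_cast hE.card_pos
  have hcard2 : (E.card : ℝ) ≤ (n : ℝ) ^ 2 := by exact_mod_cast card_defectSlots_le
  set r : ℝ := 1 - 1 / (2 * (E.card : ℝ)) with hr
  have hr0 : 0 ≤ r := by
    have : 1 / (2 * (E.card : ℝ)) ≤ 1 := by
      rw [div_le_one (by positivity)]; linarith
    linarith
  apply mixingTime_le
  intro X hX
  set t := ⌊21 * (n : ℝ) ^ 2 * Real.log n⌋₊ with ht
  refine ⟨t, le_rfl, ?_⟩
  have htv := tvDist_glauberMatrix_pow_le hE (fun X hX => ((mem_defectSets hl).1 hX).1)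
    (fun X hX Y hY => subset_mem_defectSets hl hX hY) (defectDist_nonneg (A := A) (B := B) hl)
    (fun X hX => defectDist_eq_zero hX) (sum_defectDist hl) hr0 (w := stepWeight D) (W := 2)
    (fun X f _ _ => one_le_stepWeight D X f) (fun X f hf h => stepWeight_le_two hl hf h)
    (by norm_num) (fun X f hf h => sum_coupledWeight_le hAB hl hlα hq1 hq2 hf h) hX t
  refine htv.trans_lt ?_
  have hlog : 1 / 2 ≤ Real.log n := by
    have h1 := Real.log_two_gt_d9
    have h2 := Real.log_le_log (by norm_num) hnr
    linarith
  have ht1 : 20 * (n : ℝ) ^ 2 * Real.log n ≤ t := by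
    have h1 := Nat.lt_floor_add_one (21 * (n : ℝ) ^ 2 * Real.log n)
    rw [← ht] at h1
    have h2 : 1 ≤ (n : ℝ) ^ 2 * Real.log n := by nlinarith
    linarith
  have hexp : r ^ t ≤ Real.exp (-(10 * Real.log n)) := by
    have h1 : r ≤ Real.exp (-(1 / (2 * (E.card : ℝ)))) := by
      have := Real.add_one_le_exp (-(1 / (2 * (E.card : ℝ))))
      linarith
    refine (pow_le_pow_left₀ hr0 h1 t).trans ?_
    rw [← Real.exp_nat_mul]
    apply Real.exp_le_exp.2
    have h2 : 10 * Real.log n ≤ (t : ℝ) * (1 / (2 * (E.card : ℝ))) := by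
      rw [mul_one_div, le_div_iff₀ (by positivity)]
      have := mul_le_mul_of_nonneg_left hcard2 (show 0 ≤ 20 * Real.log n by linarith)
      linarith
    linarith
  have hexp2 : Real.exp (-(10 * Real.log n)) = 1 / (n : ℝ) ^ 10 := by
    rw [Real.exp_neg, one_div, show (10 : ℝ) * Real.log n = ((10 : ℕ) : ℝ) * Real.log n by norm_num,
      Real.exp_nat_mul, Real.exp_log (by linarith)]
  rw [hexp2] at hexp
  calc 2 * (E.card : ℝ) * 2 * r ^ t ≤ 2 * (n : ℝ) ^ 2 * 2 * (1 / (n : ℝ) ^ 10) := by gcongr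
    _ = 4 / (n : ℝ) ^ 8 := by field_simp; ring
    _ < 1 / 4 := by
      rw [div_lt_div_iff₀ (by positivity) (by norm_num)]
      have : (2 : ℝ) ^ 8 ≤ (n : ℝ) ^ 8 := pow_le_pow_left₀ (by norm_num) hnr 8
      linarith

end Contraction

theorem mainTheorem4 :
    ∃ C : ℝ, 0 < C ∧ ∃ K : ℝ, 0 < K ∧
      ∀ n : ℕ, 2 ≤ n → ∀ A B : Finset (Fin n), WeaklyBalanced A B →
        ∀ lam : ℝ, C * (n : ℝ) ^ (-(1 / 2) : ℝ) ≤ lam →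
          defectMixingTime A B lam ≤ (⌊K * (n : ℝ) ^ 2 * Real.log n⌋₊ : ℕ∞) := by
  have hα := defectAlpha_pos
  have hα2 := defectAlpha_le
  -- `C = 10000 / α` makes `y = lam ^ 2 * n` at least `10 ^ 8 / α`; `K = 21` brings the
  -- contraction factor over all steps down to `n ^ (-10)`, against diameter at most `2 * n ^ 2`.
  refine ⟨10000 / defectAlpha, by positivity, 21, by norm_num, ?_⟩
  intro n hn A B hAB lam hlam
  have hnr : (2 : ℝ) ≤ n := by exact_mod_cast hn
  have hn0 : (0 : ℝ) < n := by linarith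
  have hl : 0 < lam := lt_of_lt_of_le (by positivity) hlam
  by_cases hD : ⌊defectAlpha / lam⌋₊ = 0
  · exact defectMixingTime_le_of_defectSets_eq_singleton hl
      (defectSets_eq_singleton_of_floor_eq_zero hl hD) _
  have hD1 : (1 : ℝ) ≤ (⌊defectAlpha / lam⌋₊ : ℝ) := by
    exact_mod_cast Nat.one_le_iff_ne_zero.2 hD
  have hDle : (⌊defectAlpha / lam⌋₊ : ℝ) ≤ defectAlpha / lam :=
    Nat.floor_le (div_nonneg hα.le hl.le)
  have hlα : lam ≤ defectAlpha := by
    have := hD1.trans hDle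
    rwa [one_le_div hl] at this
  have hDge : defectAlpha / lam / 2 ≤ (⌊defectAlpha / lam⌋₊ : ℝ) := by
    have := Nat.lt_floor_add_one (defectAlpha / lam)
    linarith
  set y : ℝ := lam ^ 2 * n with hy
  have hyC : 100000000 ≤ y * defectAlpha := by
    have h1 : (10000 / defectAlpha * (n : ℝ) ^ (-(1 / 2) : ℝ)) ^ 2 ≤ lam ^ 2 :=
      pow_le_pow_left₀ (by positivity) hlam 2
    have h2 : ((n : ℝ) ^ (-(1 / 2) : ℝ)) ^ 2 = (n : ℝ)⁻¹ := by
      rw [← Real.rpow_natCast, ← Real.rpow_mul hn0.le, ← Real.rpow_neg_one]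
      norm_num
    rw [mul_pow, h2] at h1
    have h3 := mul_le_mul_of_nonneg_right h1 hn0.le
    rw [mul_assoc, inv_mul_cancel₀ hn0.ne', mul_one, ← hy] at h3
    have h4 := mul_le_mul_of_nonneg_right h3 hα.le
    refine le_trans ?_ h4
    rw [div_pow, div_mul_eq_mul_div, le_div_iff₀ (by positivity)]
    nlinarith
  have hy0 : 0 < y := by positivity
  have hy1 : 100000000 ≤ y := by nlinarith
  have he := Real.exp_pos (-(y / 5))
  have hinv : Real.exp (y / 5) * Real.exp (-(y / 5)) = 1 := by
    rw [← Real.exp_add]; simp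
  have he2 : y * (y * Real.exp (-(y / 5))) ≤ 50 := by
    have h := Real.pow_div_factorial_le_exp (y / 5) (by positivity) 2
    have h2 := mul_le_mul_of_nonneg_right h he.le
    rw [hinv] at h2
    norm_num [Nat.factorial] at h2
    linarith
  have he3 : y * (y ^ 2 * Real.exp (-(y / 5))) ≤ 750 := by
    have h := Real.pow_div_factorial_le_exp (y / 5) (by positivity) 3
    have h2 := mul_le_mul_of_nonneg_right h he.le
    rw [hinv] at h2
    norm_num [Nat.factorial] at h2
    linarith
  apply defectMixingTime_le hn hAB hl hlα
  · -- `n q ≤ D / 100` amounts to a bound for `y exp (-y / 5)`.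
    have h1 : y * Real.exp (-(y / 5)) ≤ defectAlpha / 200 := by
      by_contra! h
      have := mul_lt_mul_of_pos_left h hy0
      linarith
    have h2 : n * slotProb n lam = y * Real.exp (-(y / 5)) / lam := by
      unfold slotProb
      rw [← hy, hy]
      field_simp
    rw [h2]
    calc y * Real.exp (-(y / 5)) / lam ≤ defectAlpha / 200 / lam := by gcongr
      _ = defectAlpha / lam / 2 / 100 := by ring
      _ ≤ _ := by gcongr
  · have h1 : y ^ 2 * Real.exp (-(y / 5)) ≤ 1 / 6400 := by
      by_contra! h
      have := mul_lt_mul_of_pos_left h hy0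
      linarith
    have h2 : slotProb n lam * (64 * lam ^ 3 * (n : ℝ) ^ 2)
        = 64 * (y ^ 2 * Real.exp (-(y / 5))) := by
      unfold slotProb
      rw [← hy, hy]
      ring
    rw [h2]
    linarith
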